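/- **Setting.** Let $\gamma_1,\dots,\gamma_{2n}$ be Majorana operators on a nonzero finite-dimensional complex Hilbert space: $\gamma_j^2=I$, $\gamma_j=\gamma_j^\dagger$, $\mathrm{tr}(\gamma_j)=0$, and $\gamma_j\gamma_k=-\gamma_k\gamma_j$ for $j\ne k$. A Majorana string is an operator $G=c\,\gamma_{i_1}\cdots\gamma_{i_k}$ with $c\neq0$ and $i_1<\dots<i_k$; its support is $\mathrm{supp}(G)=\{i_1,\dots,i_k\}$, and $\mathrm{supp}(0)=\emptyset$. A fermionic Hamiltonian of locality $\mathcal R\ge 2$ and degree $d\ge 1$ is $H=\sum_{a=1}^m\lambda_aG_a$ with $0\le\lambda_a\le1$, where each $G_a=\pm i^{k/2}\gamma_{i_1}\cdots\gamma_{i_k}$ ($i_1<\dots<i_k$) has nonempty support of even size $k\le\mathcal R$ and, for every $a$, at most $d$ indices $b\neq a$ satisfy $\mathrm{supp}(G_a)\cap\mathrm{supp}(G_b)\neq\emptyset$. For $S\subseteq[2n]$ let $H^S=\sum_{a:\,\mathrm{supp}(G_a)\subseteq S}\lambda_aG_a$. Fix $\beta\ge0$. A *Gaussian state* here is $\rho=\frac1{\mathrm{tr}(I)}\prod_{(k,l)\in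 M}(I\pm i\gamma_k\gamma_l)$ with $M$ a partial matching of $[2n]$ (pairs $(k,l)$, no index used twice) and a sign chosen for each pair; an *unnormalized Gaussian state* is $\lambda\rho$ with $\lambda\ge0$. **Sampling a factor.** For $i\in S\subseteq[2n]$ put $S'=S\setminus\{i\}$ and $M=e^{\beta H^{S'}/2}e^{-\beta H^{S}/2}$. Define weighted strings $(c_w,\Gamma_w)$, indexed by words $w$ over the alphabet $\{a^{L},a^{R}:1\le a\le m\}$, by $c_\emptyset=1$, $\Gamma_\emptyset=I$ and, for $w$ of length $t$: $\Gamma_{a^Lw}=G_a\Gamma_w$, with $c_{a^Lw}=\frac{\beta}{2(t+1)}\,2\lambda_ac_w$ if $\mathrm{supp}(G_a)\subseteq S'$ and $[G_a,\Gamma_w]\ne0$, and $c_{a^Lw}=0$ otherwise; $\Gamma_{a^Rw}=-\Gamma_wG_a$, with $c_{a^Rw}=\frac{\beta}{2(t+1)}\,\lambda_ac_w$ if $i\in\mathrm{supp}(G_a)\subseteq S$, and $c_{a^Rw}=0$ otherwise. For $N>0$ let $D_{S,i}$ be the distribution that produces $(t,\Lambda)=(|w|,\Gamma_w)$ with probability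 $c_w(N\mathcal R)^{|w|}$ for each nonempty word $w$, and $(0,0)$ with the remaining probability. **Algorithm.** Start with $S_0=[2n]$, $\Gamma_0=0$, $\alpha_0=0$, $\sigma_0=I$. For $j=0,\dots,2n-1$: (a) Let $i=\min(\mathrm{supp}(\Gamma_j)\cap S_j)$ if this set is nonempty, otherwise $i=\min S_j$; let $S_{j+1}=S_j\setminus\{i\}$. (b, c) Draw $(t_1,\Lambda_1)$ and $(t_2,\Lambda_2^\dagger)$ independently from $D_{S_j,i}$; let $\beta_1=(N\mathcal R)^{-t_1}$ and $\beta_2=(N\mathcal R)^{-t_2}$. (d) Set $\sigma=\sigma_j$, and let $(\Gamma,\alpha)$ be $(\Gamma_j,(1-\frac1{\mathcal R})^{-1}\alpha_j)$ with probability $1-\frac1{\mathcal R}$, and each of $(\Lambda_1,6\mathcal R\beta_1)$, $(\Lambda_2,6\mathcal R\beta_2)$, $(\Lambda_1\Gamma_j,6\mathcal R\beta_1\alpha_j)$, $(\Gamma_j\Lambda_2,6\mathcal R\alpha_j\beta_2)$, $(\Lambda_1\Lambda_2,6\mathcal R\beta_1\beta_2)$, $(\Lambda_1\Gamma_j\Lambda_2,6\mathcal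 R\beta_1\alpha_j\beta_2)$ with probability $\frac1{6\mathcal R}$. (e) If $\Gamma$ is not Hermitian, set $\Gamma\leftarrow0$, $\alpha\leftarrow0$. (f) If $\mathrm{supp}(\Gamma)\setminus S_{j+1}$ has at least two elements, let $k$ and $l$ be its least and greatest elements and write $\Gamma=\Gamma^-(i\gamma_k\gamma_l)$ (here $i$ is the imaginary unit); with probability $\frac12$ each, for the signs $\pm$, set $\Gamma\leftarrow\pm\Gamma^-$, $\sigma\leftarrow(I\pm i\gamma_k\gamma_l)\sigma$. (g) If $\Gamma\in\{I,-I\}$, set $\sigma\leftarrow(I+\alpha\Gamma)\sigma$, $\Gamma\leftarrow0$, $\alpha\leftarrow0$. Let $(\Gamma_{j+1},\alpha_{j+1},\sigma_{j+1})=(\Gamma,\alpha,\sigma)$. The output is $\sigma=\sigma_{2n}$. **Theorem.** Let $N\ge24$ be real and $0\le\beta\le\frac1{2N\mathcal Rd}$. Then: 1. For all $i\in S\subseteq[2n]$, the distribution $D_{S,i}$ is well defined (the probabilities of the nonempty words sum to at most one), and $\mathbb E[I+(N\mathcal R)^{-t}\Lambda]=M$ for $(t,\Lambda)\sim D_{S,i}$.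 2. Every output $\sigma$ of positive probability is an unnormalized Gaussian state: $\sigma=\frac{\lambda}{\mathrm{tr}(I)}\prod_{(k,l)\in M}(I\pm i\gamma_k\gamma_l)$ with $\lambda\ge0$ and $M$ a partial matching. 3. $\mathbb E[\sigma]=e^{-\beta H}$. Moreover, if $0\le\beta\le\frac1{48\mathcal Rd}$, then the Gibbs state $e^{-\beta H}/\mathrm{tr}(e^{-\beta H})$ is a convex combination of Gaussian states as above. -/

import Mathlib

open scoped ENNReal

noncomputable section

namespace HighTempFermion

/-! ### Majorana operators and fermionic Hamiltonians -/

/-- A system of `2n` Majorana operators `γ 0, …, γ (2n-1)`, acting on a finite-dimensional complex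
space with orthonormal basis indexed by `ι`. -/
structure IsMajorana {n : ℕ} {ι : Type*} [Fintype ι] [DecidableEq ι]
    (γ : Fin (2 * n) → Matrix ι ι ℂ) : Prop where
  sq_eq_one : ∀ j, γ j * γ j = 1
  isHermitian : ∀ j, (γ j).IsHermitian
  trace_eq_zero : ∀ j, (γ j).trace = 0
  anticomm : ∀ j k, j ≠ k → γ j * γ k = -(γ k * γ j)

/-- The product of the Majorana operators with index in `A`, in increasing order. -/
def majoranaProd {n : ℕ} {ι : Type*} [Fintype ι] [DecidableEq ι]
    (γ : Fin (2 * n) → Matrix ι ι ℂ) (A : Finset (Fin (2 * n))) : Matrix ι ι ℂ :=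
  (A.sort.map γ).prod

open Classical in
/-- The support of an operator of the form `c γ_{i₁} ⋯ γ_{iₖ}` with `c ≠ 0`, namely
`{i₁, …, iₖ}`. (The support of the zero operator is empty.) -/
def majoranaSupp {n : ℕ} {ι : Type*} [Fintype ι] [DecidableEq ι]
    (γ : Fin (2 * n) → Matrix ι ι ℂ) (G : Matrix ι ι ℂ) : Finset (Fin (2 * n)) :=
  Finset.univ.filter fun i =>
    ∃ A : Finset (Fin (2 * n)), i ∈ A ∧ ∃ c : ℂ, c ≠ 0 ∧ G = c • majoranaProd γ A

/-- The data of a fermionic Hamiltonian `H = ∑ₐ λₐ Gₐ` on `2n` Majorana modes, of locality `R` and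
degree `d`. The term `Gₐ` is a non-identity Hermitian Majorana string
`± i^{k/2} γ_{i₁} ⋯ γ_{iₖ}`, given by its support `{i₁ < ⋯ < iₖ}` and its sign. -/
structure FermionicHamiltonian (n R d : ℕ) where
  /-- number of terms -/
  m : ℕ
  /-- the coefficients `λₐ` -/
  coeff : Fin m → ℝ
  /-- the supports of the terms -/
  supp : Fin m → Finset (Fin (2 * n))
  /-- the signs of the terms -/
  sign : Fin m → ℤˣ
  two_le_locality : 2 ≤ R
  one_le_degree : 1 ≤ d
  coeff_nonneg : ∀ a, 0 ≤ coeff a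
  coeff_le_one : ∀ a, coeff a ≤ 1
  supp_nonempty : ∀ a, (supp a).Nonempty
  supp_even : ∀ a, Even (supp a).card
  supp_card_le : ∀ a, (supp a).card ≤ R
  degree_le : ∀ a, (Finset.univ.filter fun b => b ≠ a ∧ ¬ Disjoint (supp a) (supp b)).card ≤ d

section Algorithm

variable {n R d : ℕ} {ι : Type*} [Fintype ι] [DecidableEq ι]

/-- The Majorana string `Gₐ`. -/
def FermionicHamiltonian.G (H : FermionicHamiltonian n R d) (γ : Fin (2 * n) → Matrix ι ι ℂ)
    (a : Fin H.m) : Matrix ι ι ℂ :=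
  (((H.sign a : ℤ) : ℂ) * Complex.I ^ ((H.supp a).card / 2)) • majoranaProd γ (H.supp a)

/-- The operator `H = ∑ₐ λₐ Gₐ`. -/
def FermionicHamiltonian.op (H : FermionicHamiltonian n R d) (γ : Fin (2 * n) → Matrix ι ι ℂ) :
    Matrix ι ι ℂ :=
  ∑ a, H.coeff a • H.G γ a

/-- The restricted Hamiltonian `H^S`: the terms of `H` whose support is contained in `S`. -/
def FermionicHamiltonian.restrict (H : FermionicHamiltonian n R d)
    (γ : Fin (2 * n) → Matrix ι ι ℂ) (S : Finset (Fin (2 * n))) : Matrix ι ι ℂ :=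
  ∑ a ∈ Finset.univ.filter (fun a => H.supp a ⊆ S), H.coeff a • H.G γ a

/-- `e^{-β H}`. -/
def FermionicHamiltonian.boltzmann (H : FermionicHamiltonian n R d)
    (γ : Fin (2 * n) → Matrix ι ι ℂ) (β : ℝ) : Matrix ι ι ℂ :=
  NormedSpace.exp (-(β • H.op γ))

/-- The Gibbs state `e^{-β H} / tr(e^{-β H})`. -/
def FermionicHamiltonian.gibbs (H : FermionicHamiltonian n R d)
    (γ : Fin (2 * n) → Matrix ι ι ℂ) (β : ℝ) : Matrix ι ι ℂ :=
  (H.boltzmann γ β).trace⁻¹ • H.boltzmann γ β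

/-- The telescoping factor `M = e^{β H^{S'}/2} e^{-β H^S/2}` with `S' = S - {i}`. -/
def FermionicHamiltonian.factor (H : FermionicHamiltonian n R d)
    (γ : Fin (2 * n) → Matrix ι ι ℂ) (β : ℝ) (S : Finset (Fin (2 * n))) (i : Fin (2 * n)) :
    Matrix ι ι ℂ :=
  NormedSpace.exp ((β / 2) • H.restrict γ (S.erase i)) *
    NormedSpace.exp (-((β / 2) • H.restrict γ S))

/-! ### Gaussian states attached to signed partial matchings -/

/-- A list of signed pairs `(k, l, ±1)` is a partial matching of the `2n` indices when no index
occurs twice in it. -/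
def IsPartialMatching (M : List (Fin (2 * n) × Fin (2 * n) × ℤˣ)) : Prop :=
  (M.flatMap fun p => [p.1, p.2.1]).Nodup

/-- `∏_{(k,l) ∈ M} (I ± i γ_k γ_l)`; for a partial matching, the factors commute. -/
def matchingProd (γ : Fin (2 * n) → Matrix ι ι ℂ)
    (M : List (Fin (2 * n) × Fin (2 * n) × ℤˣ)) : Matrix ι ι ℂ :=
  (M.map fun p =>
    (1 : Matrix ι ι ℂ) + (((p.2.2 : ℤ) : ℂ) * Complex.I) • (γ p.1 * γ p.2.1)).prod

/-- `σ = λ ∏_{(k,l) ∈ M} (I ± i γ_k γ_l) / tr(I)` with `λ ≥ 0` and `M` a partial matching. -/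
def IsUnnormalizedGaussian (γ : Fin (2 * n) → Matrix ι ι ℂ) (σ : Matrix ι ι ℂ) : Prop :=
  ∃ (lam : ℝ) (M : List (Fin (2 * n) × Fin (2 * n) × ℤˣ)), 0 ≤ lam ∧ IsPartialMatching M ∧
    σ = ((lam : ℂ) / Matrix.trace (1 : Matrix ι ι ℂ)) • matchingProd γ M

/-- `ρ = ∏_{(k,l) ∈ M} (I ± i γ_k γ_l) / tr(I)` with `M` a partial matching. -/
def IsGaussianState (γ : Fin (2 * n) → Matrix ι ι ℂ) (ρ : Matrix ι ι ℂ) : Prop :=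
  ∃ M : List (Fin (2 * n) × Fin (2 * n) × ℤˣ), IsPartialMatching M ∧
    ρ = (Matrix.trace (1 : Matrix ι ι ℂ))⁻¹ • matchingProd γ M

/-! ### The distribution over operators `I + (N R)^{-t} Γ` with expectation `M`

Writing `A = H^{S'}`, `B = H^S`, the degree `t` part `p_t` of the series of `M = e^{βA/2} e^{-βB/2}`
satisfies `p_0 = I` and `p_{t+1} = β / (2(t+1)) * ([A, p_t] - p_t (B - A))`. Unfolding this recursion
gives `p_t` as a sum of terms `c_w Γ_w`, indexed by words `w` of length `t`: the letter `inl a`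
stands for a contribution of `Gₐ` to the commutator, `inr a` for one to the second product. -/

/-- The Majorana string `Γ_w`. -/
def wordOp (H : FermionicHamiltonian n R d) (γ : Fin (2 * n) → Matrix ι ι ℂ) :
    List (Fin H.m ⊕ Fin H.m) → Matrix ι ι ℂ
  | [] => 1
  | Sum.inl a :: w => H.G γ a * wordOp H γ w
  | Sum.inr a :: w => -(wordOp H γ w * H.G γ a)

open Classical in
/-- The coefficient `c_w ≥ 0`. -/
def wordCoeff (H : FermionicHamiltonian n R d) (γ : Fin (2 * n) → Matrix ι ι ℂ) (β : ℝ)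
    (S : Finset (Fin (2 * n))) (i : Fin (2 * n)) : List (Fin H.m ⊕ Fin H.m) → ℝ
  | [] => 1
  | Sum.inl a :: w =>
      if H.supp a ⊆ S.erase i ∧ ¬ Commute (H.G γ a) (wordOp H γ w) then
        β / (2 * (w.length + 1)) * (2 * H.coeff a * wordCoeff H γ β S i w)
      else 0
  | Sum.inr a :: w =>
      if H.supp a ⊆ S ∧ i ∈ H.supp a then
        β / (2 * (w.length + 1)) * (H.coeff a * wordCoeff H γ β S i w)
      else 0

/-- The probability of the word `w`: it is `c_w (N R)^t` if `w` has length `t > 0`, and the empty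
word takes the remaining mass. -/
def wordProb (H : FermionicHamiltonian n R d) (γ : Fin (2 * n) → Matrix ι ι ℂ) (β N : ℝ)
    (S : Finset (Fin (2 * n))) (i : Fin (2 * n)) (w : List (Fin H.m ⊕ Fin H.m)) : ℝ≥0∞ :=
  if w = [] then
    1 - ∑' v : {v : List (Fin H.m ⊕ Fin H.m) // v ≠ []},
      ENNReal.ofReal (wordCoeff H γ β S i v.1 * (N * R) ^ v.1.length)
  else ENNReal.ofReal (wordCoeff H γ β S i w * (N * R) ^ w.length)

open Classical in
/-- The distribution of the sampled word. The second branch is a dummy value, for parameters at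
which the numbers `wordProb` do not sum to one. -/
def wordPMF (H : FermionicHamiltonian n R d) (γ : Fin (2 * n) → Matrix ι ι ℂ) (β N : ℝ)
    (S : Finset (Fin (2 * n))) (i : Fin (2 * n)) : PMF (List (Fin H.m ⊕ Fin H.m)) :=
  if h : ∑' w, wordProb H γ β N S i w = 1 then
    ⟨wordProb H γ β N S i, h ▸ ENNReal.summable.hasSum⟩
  else PMF.pure []

/-- The sampled string: `Γ_w` for a nonempty word, and `0` for the empty word. -/
def sampledString (H : FermionicHamiltonian n R d) (γ : Fin (2 * n) → Matrix ι ι ℂ)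
    (w : List (Fin H.m ⊕ Fin H.m)) : Matrix ι ι ℂ :=
  if w = [] then 0 else wordOp H γ w

/-- The sampled scale `(N R)^{-t}`, with `t` the length of the word. -/
def sampledScale (H : FermionicHamiltonian n R d) (N : ℝ) (w : List (Fin H.m ⊕ Fin H.m)) : ℝ :=
  ((N * R) ^ w.length)⁻¹

/-! ### The structural algorithm -/

/-- The state `(S_j, Γ_j, α_j, σ_j)` of the algorithm. -/
structure AlgState (n : ℕ) (ι : Type*) where
  S : Finset (Fin (2 * n))
  Γ : Matrix ι ι ℂ
  α : ℝ
  σ : Matrix ι ι ℂ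

/-- The initial state `S_0 = [2n]`, `Γ_0 = 0`, `α_0 = 0`, `σ_0 = I`. -/
def AlgState.init (n : ℕ) (ι : Type*) [DecidableEq ι] : AlgState n ι :=
  ⟨Finset.univ, 0, 0, 1⟩

/-- Step (a): the minimal index of `T ∩ S` if this set is nonempty, else the minimal index
of `S`. -/
def pickSite (T S : Finset (Fin (2 * n))) (hS : S.Nonempty) : Fin (2 * n) :=
  if h : (T ∩ S).Nonempty then (T ∩ S).min' h else S.min' hS

/-- The probabilities `1 - 1/R, 1/(6R), …, 1/(6R)` of the seven updates of step (d). -/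
def updateProb (R : ℕ) (x : Fin 7) : ℝ≥0∞ :=
  if x = 0 then 1 - (R : ℝ≥0∞)⁻¹ else (6 * (R : ℝ≥0∞))⁻¹

theorem sum_updateProb {R : ℕ} (hR : 2 ≤ R) : ∑ x, updateProb R x = 1 := by
  have h1 : (1 : ℝ≥0∞) ≤ R := by exact_mod_cast (by omega : 1 ≤ R)
  have h6 : (6 : ℝ≥0∞) * 6⁻¹ = 1 := ENNReal.mul_inv_cancel (by norm_num) (by norm_num)
  have h : (6 : ℝ≥0∞) * (6 * (R : ℝ≥0∞))⁻¹ = (R : ℝ≥0∞)⁻¹ := by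
    rw [ENNReal.mul_inv (by simp) (by simp), ← mul_assoc, h6, one_mul]
  rw [Fin.sum_univ_succ]
  simp only [updateProb, if_true, Fin.succ_ne_zero, if_false, Finset.sum_const, Finset.card_univ,
    Fintype.card_fin, nsmul_eq_mul]
  push_cast
  rw [h]
  exact tsub_add_cancel_of_le (ENNReal.inv_le_one.2 h1)

/-- The choice of the update in step (d). -/
def updatePMF (R : ℕ) (hR : 2 ≤ R) : PMF (Fin 7) :=
  PMF.ofFintype (updateProb R) (sum_updateProb hR)

/-- Step (d): the new values of `(Γ, α)` under the seven updates. -/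
def update (R : ℕ) (Γ : Matrix ι ι ℂ) (α : ℝ) (Λ₁ Λ₂ : Matrix ι ι ℂ) (b₁ b₂ : ℝ) :
    Fin 7 → Matrix ι ι ℂ × ℝ :=
  ![(Γ, (1 - 1 / (R : ℝ))⁻¹ * α),
    (Λ₁, 6 * R * b₁),
    (Λ₂, 6 * R * b₂),
    (Λ₁ * Γ, 6 * R * (b₁ * α)),
    (Γ * Λ₂, 6 * R * (α * b₂)),
    (Λ₁ * Λ₂, 6 * R * (b₁ * b₂)),
    (Λ₁ * Γ * Λ₂, 6 * R * (b₁ * α * b₂))]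

open Classical in
/-- Step (e): discard `Γ` if it is not Hermitian. -/
def discard (s : AlgState n ι) : AlgState n ι :=
  if s.Γ.IsHermitian then s else { s with Γ := 0, α := 0 }

/-- Step (f): if there are two indices `k < l` in the support of `Γ` outside the current set `S`,
write `Γ = Γ⁻ (i γ_k γ_l)` and pin `k, l` with a uniformly random sign. (Here
`Γ⁻ = Γ (i γ_k γ_l)`, because `i γ_k γ_l` squares to the identity.) -/
def pin (γ : Fin (2 * n) → Matrix ι ι ℂ) (s : AlgState n ι) : PMF (AlgState n ι) :=
  if h : 1 < (majoranaSupp γ s.Γ \ s.S).card then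
    let U := majoranaSupp γ s.Γ \ s.S
    let k := U.min' (Finset.card_pos.1 (Nat.zero_lt_of_lt h))
    let l := U.max' (Finset.card_pos.1 (Nat.zero_lt_of_lt h))
    let P := Complex.I • (γ k * γ l)
    (PMF.uniformOfFintype Bool).map fun b =>
      if b then { s with Γ := s.Γ * P, σ := (1 + P) * s.σ }
      else { s with Γ := -(s.Γ * P), σ := (1 - P) * s.σ }
  else PMF.pure s

open Classical in
/-- Step (g): if `Γ = ± I`, absorb the scalar `I + α Γ` into `σ`. -/
def absorb (s : AlgState n ι) : AlgState n ι :=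
  if s.Γ = 1 ∨ s.Γ = -1 then { s with Γ := 0, α := 0, σ := (1 + s.α • s.Γ) * s.σ } else s

/-- One iteration of the algorithm, steps (a) to (g). The two words are sampled independently from
the same distribution, and `Λ₂` is the adjoint of the string of the second word, so that
`I + b₁ Λ₁` and `I + b₂ Λ₂` are samples for `M` and for its adjoint. The set `S` is nonempty
in each of the `2n` iterations of the algorithm. -/
def algStep (H : FermionicHamiltonian n R d) (γ : Fin (2 * n) → Matrix ι ι ℂ) (β N : ℝ)
    (s : AlgState n ι) : PMF (AlgState n ι) :=
  if hS : s.S.Nonempty then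
    let i := pickSite (majoranaSupp γ s.Γ) s.S hS
    (wordPMF H γ β N s.S i).bind fun w₁ =>
    (wordPMF H γ β N s.S i).bind fun w₂ =>
    (updatePMF R H.two_le_locality).bind fun x =>
      let u := update R s.Γ s.α (sampledString H γ w₁) (sampledString H γ w₂).conjTranspose
        (sampledScale H N w₁) (sampledScale H N w₂) x
      (pin γ (discard ⟨s.S.erase i, u.1, u.2, s.σ⟩)).map absorb
  else PMF.pure s

/-- The random state after `j` iterations. -/
def algRun (H : FermionicHamiltonian n R d) (γ : Fin (2 * n) → Matrix ι ι ℂ) (β N : ℝ) :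
    ℕ → PMF (AlgState n ι)
  | 0 => PMF.pure (AlgState.init n ι)
  | j + 1 => (algRun H γ β N j).bind (algStep H γ β N)

/-- The distribution of the output `σ = σ_{2n}` of the algorithm. -/
def structuralAlgorithm (H : FermionicHamiltonian n R d) (γ : Fin (2 * n) → Matrix ι ι ℂ)
    (β N : ℝ) : PMF (Matrix ι ι ℂ) :=
  (algRun H γ β N (2 * n)).map AlgState.σ

end Algorithm

end HighTempFermion

end

/-! Write E_S = e^{-βH^S/2}, let S' = S \ {i}, and let M be the factor at i. Then E_{S'} M = E_S =
M† E_{S'}. The pairs already in σ avoid S and the terms of H^S are even, so M† commutes with σ, and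
E_S Y σ E_S = E_{S'} (M Y M†) σ E_{S'} for every Y. The algorithm is therefore a martingale for
`stateValue`, the operator E_S (1 + αΓ) σ E_S. Its initial value is e^{-βH}; at the end S is empty
and Γ = 0, so its final value is σ (`hasMean_algStep`, `algRun_spec`).

Each random choice is unbiased for its own reason. The two sampled factors are independent with
means M and M†. The seven updates are, besides the identity, the terms in the expansion of (1 +
b₁Λ₁)(1 + αΓ)(1 + b₂Λ₂). Dropping a non-Hermitian string is the Hermitian-part map, which is
real-linear and fixes the mean, since M(1 + αΓ)M† is Hermitian. Pinning averages correctly because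
(iγ_kγ_l)² = 1.

The output stays a nonnegative multiple of a matching product because of the bound α ≤ (1 -
1/R)^{|supp Γ ∩ S|} (`IsPiece`, `AlgInv`). Keeping Γ multiplies α by (1 - 1/R)⁻¹, but the chosen
site lies in supp Γ and leaves S. The other updates cost a factor 6R, paid by the scale (NR)^{-t} of
a sampled string on at most tR modes (`scale_le_decay`). So α ≤ 1 whenever Γ = ±1, and the absorbed
scalar 1 ± α is nonnegative. Between iterations at most one mode of Γ lies outside S; removing i
makes this at most two, and pinning then removes both.

The word expansion of M comes from the recursion for the homogeneous parts of e^X e^Y. Prepending a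
letter costs at most βd in total weight (`sum_wordCoeff_cons_le`), so after rescaling by NR the
words of length t weigh at most 2^{-t}.

For the Gibbs state, the series of outputs is grouped by the finitely many trace-one Gaussian states
and divided by its trace (`mem_convexHull_of_hasSum`). -/

namespace HighTempFermion

open Matrix

section Strings

variable {n : ℕ} {ι : Type*} [Fintype ι] [DecidableEq ι] {γ : Fin (2 * n) → Matrix ι ι ℂ}

/-! ### Majorana strings -/

/-- `G` is a Majorana string with support `A`, with a fourth root of unity as its phase. -/
def IsString (γ : Fin (2 * n) → Matrix ι ι ℂ) (A : Finset (Fin (2 * n))) (G : Matrix ι ι ℂ) :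
    Prop :=
  ∃ c : ℂ, c ^ 4 = 1 ∧ G = c • majoranaProd γ A

theorem IsString.smul {A : Finset (Fin (2 * n))} {G : Matrix ι ι ℂ} (h : IsString γ A G) {c : ℂ}
    (hc : c ^ 4 = 1) : IsString γ A (c • G) := by
  obtain ⟨b, hb, rfl⟩ := h
  exact ⟨c * b, by rw [mul_pow, hb, hc, one_mul], by rw [smul_smul]⟩

theorem IsString.neg {A : Finset (Fin (2 * n))} {G : Matrix ι ι ℂ} (h : IsString γ A G) :
    IsString γ A (-G) := by
  simpa using h.smul (c := -1) (by norm_num)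

theorem isString_one : IsString γ ∅ (1 : Matrix ι ι ℂ) :=
  ⟨1, by norm_num, by simp [majoranaProd]⟩

theorem IsMajorana.isUnit (hγ : IsMajorana γ) (j : Fin (2 * n)) : IsUnit (γ j) :=
  IsUnit.of_mul_eq_one _ (hγ.sq_eq_one j)

theorem IsMajorana.isUnit_majoranaProd (hγ : IsMajorana γ) (A : Finset (Fin (2 * n))) :
    IsUnit (majoranaProd γ A) := by
  unfold majoranaProd
  induction A.sort with
  | nil => simp
  | cons j l ih => simpa using (hγ.isUnit j).mul ih

theorem IsMajorana.prod_perm (hγ : IsMajorana γ) {l l' : List (Fin (2 * n))} (h : l.Perm l') :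
    (l.map γ).prod = (l'.map γ).prod ∨ (l.map γ).prod = -(l'.map γ).prod := by
  induction h with
  | nil => simp
  | cons x _ ih =>
    rcases ih with h | h <;> simp [h]
  | swap x y l =>
    simp only [List.map_cons, List.prod_cons, ← mul_assoc]
    by_cases hxy : x = y
    · simp [hxy]
    · right; rw [hγ.anticomm x y hxy]; simp
  | trans _ _ ih₁ ih₂ =>
    rcases ih₁ with h₁ | h₁ <;> rcases ih₂ with h₂ | h₂ <;> simp [h₁, h₂]

theorem IsMajorana.isString_prod (hγ : IsMajorana γ) {l : List (Fin (2 * n))} (hl : l.Nodup) :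
    IsString γ l.toFinset (l.map γ).prod := by
  have hp : l.Perm (l.toFinset.sort) :=
    ((Finset.sort_perm_toList _ _).trans (List.toFinset_toList hl)).symm
  rcases hγ.prod_perm hp with h | h
  · exact ⟨1, by norm_num, by rw [h, one_smul]; rfl⟩
  · exact ⟨-1, by norm_num, by rw [h, neg_one_smul]; rfl⟩

theorem IsMajorana.isString_mul_insert (hγ : IsMajorana γ) {j : Fin (2 * n)}
    {A : Finset (Fin (2 * n))} (hj : j ∉ A) :
    IsString γ (insert j A) (γ j * majoranaProd γ A) := by
  have h := hγ.isString_prod (l := j :: A.sort) (by simp [hj])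
  simpa [majoranaProd] using h

theorem IsMajorana.isString_mul_erase (hγ : IsMajorana γ) {j : Fin (2 * n)}
    {A : Finset (Fin (2 * n))} (hj : j ∈ A) :
    IsString γ (A.erase j) (γ j * majoranaProd γ A) := by
  obtain ⟨c, hc, h⟩ := hγ.isString_mul_insert (Finset.notMem_erase j A)
  rw [Finset.insert_erase hj] at h
  have hc0 : c ≠ 0 := by rintro rfl; norm_num at hc
  refine ⟨c⁻¹, by rw [inv_pow, hc, inv_one], ?_⟩
  rw [eq_inv_smul_iff₀ hc0, ← mul_smul_comm, ← h, ← mul_assoc, hγ.sq_eq_one, one_mul]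

theorem IsMajorana.isString_mul_left (hγ : IsMajorana γ) (j : Fin (2 * n))
    {A : Finset (Fin (2 * n))} {G : Matrix ι ι ℂ} (h : IsString γ A G) :
    IsString γ (symmDiff {j} A) (γ j * G) := by
  obtain ⟨c, hc, rfl⟩ := h
  rw [mul_smul_comm]
  by_cases hj : j ∈ A
  · have : symmDiff {j} A = A.erase j := by ext x; simp [Finset.mem_symmDiff]; grind
    rw [this]; exact (hγ.isString_mul_erase hj).smul hc
  · have : symmDiff {j} A = insert j A := by ext x; simp [Finset.mem_symmDiff]; grind
    rw [this]; exact (hγ.isString_mul_insert hj).smul hc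

theorem IsMajorana.isString_list_mul (hγ : IsMajorana γ) {l : List (Fin (2 * n))} (hl : l.Nodup)
    {A : Finset (Fin (2 * n))} {G : Matrix ι ι ℂ} (h : IsString γ A G) :
    IsString γ (symmDiff l.toFinset A) ((l.map γ).prod * G) := by
  induction l with
  | nil =>
    have : symmDiff ∅ A = A := bot_symmDiff A
    simpa [this] using h
  | cons j l ih =>
    rw [List.nodup_cons] at hl
    have := hγ.isString_mul_left j (ih hl.2)
    rw [← symmDiff_assoc] at this
    have h2 : symmDiff {j} l.toFinset = (j :: l).toFinset := by
      ext x; simp [Finset.mem_symmDiff]; grind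
    rw [h2] at this
    simpa [mul_assoc] using this

theorem IsString.mul (hγ : IsMajorana γ) {A B : Finset (Fin (2 * n))} {F G : Matrix ι ι ℂ}
    (hF : IsString γ A F) (hG : IsString γ B G) : IsString γ (symmDiff A B) (F * G) := by
  obtain ⟨c, hc, rfl⟩ := hF
  have := hγ.isString_list_mul (l := A.sort) (by simp) hG
  rw [Finset.sort_toFinset] at this
  rw [smul_mul_assoc]
  exact this.smul hc

theorem even_card_symmDiff {α : Type*} [DecidableEq α] {A B : Finset α} (hA : Even A.card)
    (hB : Even B.card) : Even (symmDiff A B).card := by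
  have h1 : (symmDiff A B).card = (A \ B).card + (B \ A).card :=
    Finset.card_union_of_disjoint disjoint_sdiff_sdiff
  have h2 := Finset.card_sdiff_add_card_inter A B
  have h3 := Finset.card_sdiff_add_card_inter B A
  rw [Finset.inter_comm] at h3
  grind

theorem IsMajorana.mul_list_prod (hγ : IsMajorana γ) (j : Fin (2 * n)) (l : List (Fin (2 * n))) :
    γ j * (l.map γ).prod =
      (-1 : ℂ) ^ (l.filter (fun x => x ≠ j)).length • ((l.map γ).prod * γ j) := by
  induction l with
  | nil => simp
  | cons x l ih =>
    simp only [List.map_cons, List.prod_cons]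
    by_cases hx : x = j
    · subst hx
      rw [mul_assoc, ih]
      simp
    · have h1 : (x :: l).filter (fun x => x ≠ j) = x :: l.filter (fun x => x ≠ j) := by
        simp [hx]
      rw [h1, List.length_cons, ← mul_assoc, hγ.anticomm j x (Ne.symm hx), neg_mul, mul_assoc, ih,
        mul_smul_comm, pow_succ, mul_neg_one, neg_smul, mul_assoc]

theorem IsMajorana.mul_majoranaProd (hγ : IsMajorana γ) (j : Fin (2 * n))
    (A : Finset (Fin (2 * n))) :
    γ j * majoranaProd γ A = (-1 : ℂ) ^ (A.erase j).card • (majoranaProd γ A * γ j) := by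
  rw [majoranaProd, hγ.mul_list_prod]
  congr 2
  have h : (A.sort.filter (fun x => x ≠ j)).toFinset = A.erase j := by
    ext x; simp [and_comm]
  rw [← h, List.toFinset_card_of_nodup]
  exact (Finset.sort_nodup _ _).filter _

theorem IsString.majorana_mul (hγ : IsMajorana γ) (j : Fin (2 * n))
    {A : Finset (Fin (2 * n))} {G : Matrix ι ι ℂ} (h : IsString γ A G) :
    γ j * G = (-1 : ℂ) ^ (A.erase j).card • (G * γ j) := by
  obtain ⟨c, hc, rfl⟩ := h
  rw [mul_smul_comm, hγ.mul_majoranaProd, smul_comm, smul_mul_assoc]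

theorem IsString.commute_majorana (hγ : IsMajorana γ) {j : Fin (2 * n)}
    {A : Finset (Fin (2 * n))} {G : Matrix ι ι ℂ} (h : IsString γ A G) (hA : Even A.card)
    (hj : j ∉ A) : Commute (γ j) G := by
  have := h.majorana_mul hγ j
  rwa [Finset.erase_eq_of_notMem hj, hA.neg_one_pow, one_smul] at this

theorem IsString.anticommute_majorana (hγ : IsMajorana γ) {j : Fin (2 * n)}
    {A : Finset (Fin (2 * n))} {G : Matrix ι ι ℂ} (h : IsString γ A G) (hA : Even A.card)
    (hj : j ∈ A) : γ j * G = -(G * γ j) := by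
  have := h.majorana_mul hγ j
  have ho : Odd (A.erase j).card := by
    rw [Finset.card_erase_of_mem hj]
    have := Finset.card_pos.2 ⟨j, hj⟩
    exact Nat.Even.sub_odd (by omega) hA odd_one
  rwa [ho.neg_one_pow, neg_one_smul] at this

theorem IsString.commute_of_forall {A : Finset (Fin (2 * n))}
    {G X : Matrix ι ι ℂ} (h : IsString γ A G) (hX : ∀ j ∈ A, Commute X (γ j)) : Commute X G := by
  obtain ⟨c, -, rfl⟩ := h
  refine Commute.smul_right ?_ c
  refine Commute.list_prod_right _ _ fun m hm => ?_
  obtain ⟨j, hj, rfl⟩ := List.mem_map.1 hm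
  exact hX j (by simpa using hj)

theorem IsString.commute_of_disjoint (hγ : IsMajorana γ) {A B : Finset (Fin (2 * n))}
    {F G : Matrix ι ι ℂ} (hF : IsString γ A F) (hG : IsString γ B G) (hA : Even A.card)
    (h : Disjoint A B) : Commute F G :=
  hG.commute_of_forall fun _ hj =>
    (hF.commute_majorana hγ hA (Finset.disjoint_right.1 h hj)).symm

theorem IsString.commute_or_anticommute (hγ : IsMajorana γ) {A B : Finset (Fin (2 * n))}
    {F G : Matrix ι ι ℂ} (hF : IsString γ A F) (hG : IsString γ B G) :
    Commute F G ∨ F * G = -(G * F) := by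
  have hl : ∀ l : List (Fin (2 * n)), ∃ ε : ℂ, (ε = 1 ∨ ε = -1) ∧
      (l.map γ).prod * G = ε • (G * (l.map γ).prod) := by
    intro l
    induction l with
    | nil => exact ⟨1, .inl rfl, by simp⟩
    | cons j l ih =>
      obtain ⟨ε, hε, h⟩ := ih
      refine ⟨ε * (-1) ^ (B.erase j).card, ?_, ?_⟩
      · rcases neg_one_pow_eq_or ℂ (B.erase j).card with h | h <;> rcases hε with h' | h' <;>
          simp [h, h']
      · rw [List.map_cons, List.prod_cons, mul_assoc, h, mul_smul_comm, ← mul_assoc,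
          hG.majorana_mul hγ j, smul_mul_assoc, mul_assoc, smul_smul]
  obtain ⟨c, -, rfl⟩ := hF
  obtain ⟨ε, hε, h⟩ := hl A.sort
  have h' : majoranaProd γ A * G = ε • (G * majoranaProd γ A) := h
  rcases hε with rfl | rfl
  · left
    rw [one_smul] at h'
    exact Commute.smul_left h' c
  · right
    rw [smul_mul_assoc, h', mul_smul_comm, smul_comm, neg_one_smul]

theorem IsMajorana.conjTranspose_prod (hγ : IsMajorana γ) (l : List (Fin (2 * n))) :
    (l.map γ).prodᴴ = (l.reverse.map γ).prod := by
  induction l with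
  | nil => simp
  | cons j l ih => simp [ih, (hγ.isHermitian j).eq]

/-- Moving the head past the tail costs one sign per tail element, and Pascal's rule adds these up
to a binomial coefficient. -/
theorem IsMajorana.prod_reverse (hγ : IsMajorana γ) {l : List (Fin (2 * n))} (hl : l.Nodup) :
    (l.reverse.map γ).prod = (-1 : ℂ) ^ l.length.choose 2 • (l.map γ).prod := by
  induction l with
  | nil => simp
  | cons j l ih =>
    rw [List.nodup_cons] at hl
    have h := hγ.mul_list_prod j l
    have hf : l.filter (fun x => x ≠ j) = l := by
      rw [List.filter_eq_self]
      intro x hx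
      simpa using ne_of_mem_of_not_mem hx hl.1
    rw [hf] at h
    rw [List.reverse_cons, List.map_append, List.prod_append, ih hl.2, List.map_singleton,
      List.prod_singleton, List.map_cons,
      List.prod_cons, h, List.length_cons, Nat.choose_succ_succ' l.length 1, Nat.choose_one_right,
      pow_add, smul_smul]
    have h1 : (-1 : ℂ) ^ l.length * (-1) ^ l.length = 1 := by
      rw [← mul_pow]; norm_num
    rw [mul_right_comm, h1, one_mul]
    simp

/-- A fourth root of unity is real or purely imaginary, and the adjoint of the ordered product is a
reordering of it. This dichotomy is what lets discarding be read as taking a Hermitian part. -/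
theorem IsString.conjTranspose (hγ : IsMajorana γ) {A : Finset (Fin (2 * n))} {G : Matrix ι ι ℂ}
    (h : IsString γ A G) : Gᴴ = G ∨ Gᴴ = -G := by
  obtain ⟨c, hc, rfl⟩ := h
  have hstar : Star.star c = c ∨ Star.star c = -c := by
    have h2 : (c ^ 2 - 1) * (c ^ 2 + 1) = 0 := by linear_combination hc
    rcases mul_eq_zero.1 h2 with h | h
    · have : (c - 1) * (c + 1) = 0 := by linear_combination h
      rcases mul_eq_zero.1 this with h | h
      · left; rw [sub_eq_zero.1 h]; simp
      · left; rw [eq_neg_of_add_eq_zero_left h]; simp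
    · have : (c - Complex.I) * (c + Complex.I) = 0 := by
        linear_combination h - Complex.I_sq
      rcases mul_eq_zero.1 this with h | h
      · right; rw [sub_eq_zero.1 h]; simp
      · right; rw [eq_neg_of_add_eq_zero_left h]; simp
  have hp : (majoranaProd γ A)ᴴ = majoranaProd γ A ∨ (majoranaProd γ A)ᴴ = -majoranaProd γ A := by
    rw [majoranaProd, hγ.conjTranspose_prod]
    exact hγ.prod_perm (List.reverse_perm _)
  rw [conjTranspose_smul]
  rcases hstar with h | h <;> rcases hp with h' | h' <;> simp [h, h']

theorem IsString.star (hγ : IsMajorana γ) {A : Finset (Fin (2 * n))} {G : Matrix ι ι ℂ}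
    (h : IsString γ A G) : IsString γ A Gᴴ := by
  rcases h.conjTranspose hγ with h' | h' <;> rw [h']
  exacts [h, h.neg]

theorem IsString.mul_conjTranspose (hγ : IsMajorana γ) {A : Finset (Fin (2 * n))}
    {G : Matrix ι ι ℂ} (h : IsString γ A G) : Gᴴ * G = 1 := by
  obtain ⟨c, hc, rfl⟩ := h
  have hc1 : Star.star c * c = 1 := by
    have : ‖c‖ = 1 := by
      have h4 : ‖c‖ ^ 4 = 1 := by rw [← norm_pow, hc, norm_one]
      exact (pow_eq_one_iff_of_nonneg (norm_nonneg c) (by norm_num)).1 h4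
    have h5 := Complex.conj_mul' c
    rw [this] at h5
    simpa using h5
  have hp : ∀ l : List (Fin (2 * n)), (l.map γ).prodᴴ * (l.map γ).prod = 1 := by
    intro l
    induction l with
    | nil => simp
    | cons j l ih =>
      simp only [List.map_cons, List.prod_cons, conjTranspose_mul, (hγ.isHermitian j).eq]
      rw [mul_assoc, ← mul_assoc (γ j), hγ.sq_eq_one, one_mul, ih]
  rw [conjTranspose_smul, smul_mul_smul_comm, hc1, one_smul]
  exact hp _

/-! ### The support of a string -/

/-- Commuting γ_j through a string reveals the parity of the support without j. Comparing over all j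
gives A = B when the cardinalities have the same parity, and B = Aᶜ otherwise. The latter is
impossible because the number of modes is even. -/
theorem IsMajorana.finset_eq_of_smul_eq [Nonempty ι] (hγ : IsMajorana γ)
    {A B : Finset (Fin (2 * n))} {a b : ℂ} (ha : a ≠ 0)
    (h : a • majoranaProd γ A = b • majoranaProd γ B) : A = B := by
  have hA0 : majoranaProd γ A ≠ 0 := (hγ.isUnit_majoranaProd A).ne_zero
  have hpar : ∀ j, (A.erase j).card % 2 = (B.erase j).card % 2 := by
    intro j
    have hA := hγ.mul_majoranaProd j A
    have hB := hγ.mul_majoranaProd j B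
    have h1 : γ j * (a • majoranaProd γ A) =
        (-1 : ℂ) ^ (A.erase j).card • (a • majoranaProd γ A * γ j) := by
      rw [mul_smul_comm, hA, smul_comm, smul_mul_assoc]
    have h2 : γ j * (b • majoranaProd γ B) =
        (-1 : ℂ) ^ (B.erase j).card • (b • majoranaProd γ B * γ j) := by
      rw [mul_smul_comm, hB, smul_comm, smul_mul_assoc]
    rw [← h, h1] at h2
    have hne : a • majoranaProd γ A * γ j ≠ 0 := by
      rw [smul_mul_assoc]
      exact smul_ne_zero ha ((hγ.isUnit_majoranaProd A).mul (hγ.isUnit j)).ne_zero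
    have h3 : (-1 : ℂ) ^ (A.erase j).card = (-1 : ℂ) ^ (B.erase j).card :=
      smul_left_injective ℂ hne h2
    rcases Nat.even_or_odd (A.erase j).card with hA | hA <;>
      rcases Nat.even_or_odd (B.erase j).card with hB | hB
    · grind
    · rw [hA.neg_one_pow, hB.neg_one_pow] at h3; norm_num at h3
    · rw [hA.neg_one_pow, hB.neg_one_pow] at h3; norm_num at h3
    · grind
  have hcard : ∀ (C : Finset (Fin (2 * n))) j, (C.erase j).card + (if j ∈ C then 1 else 0) =
      C.card := by
    intro C j
    by_cases hj : j ∈ C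
    · rw [if_pos hj, Finset.card_erase_add_one hj]
    · simp [hj]
  by_cases hAB : A.card % 2 = B.card % 2
  · ext j
    have h1 := hpar j
    have h2 := hcard A j
    have h3 := hcard B j
    by_cases hjA : j ∈ A <;> by_cases hjB : j ∈ B <;> simp_all <;> omega
  · exfalso
    have hc : B = Aᶜ := by
      ext j
      rw [Finset.mem_compl]
      have h1 := hpar j
      have h2 := hcard A j
      have h3 := hcard B j
      by_cases hjA : j ∈ A <;> by_cases hjB : j ∈ B <;> simp_all
      omega
    have := Finset.card_add_card_compl A
    rw [← hc, Fintype.card_fin] at this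
    omega

theorem IsString.majoranaSupp_eq [Nonempty ι] (hγ : IsMajorana γ) {A : Finset (Fin (2 * n))}
    {G : Matrix ι ι ℂ} (h : IsString γ A G) : majoranaSupp γ G = A := by
  obtain ⟨c, hc, rfl⟩ := h
  have hc0 : c ≠ 0 := by rintro rfl; norm_num at hc
  ext j
  simp only [majoranaSupp, Finset.mem_filter, Finset.mem_univ, true_and]
  constructor
  · rintro ⟨B, hj, b, hb, h⟩
    rwa [hγ.finset_eq_of_smul_eq hc0 h]
  · exact fun hj => ⟨A, hj, c, hc0, rfl⟩

theorem IsMajorana.majoranaSupp_zero [Nonempty ι] (hγ : IsMajorana γ) :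
    majoranaSupp γ (0 : Matrix ι ι ℂ) = ∅ := by
  ext j
  simp only [majoranaSupp, Finset.mem_filter, Finset.mem_univ, true_and, Finset.notMem_empty,
    iff_false]
  rintro ⟨B, -, b, hb, h⟩
  exact smul_ne_zero hb (hγ.isUnit_majoranaProd B).ne_zero h.symm

/-- A real fourth root of unity is ±1. Hence the test Γ = ±1 of the absorbing step catches every
Hermitian string with empty support. -/
theorem IsString.eq_one_or_of_isHermitian [Nonempty ι] {G : Matrix ι ι ℂ} (h : IsString γ ∅ G)
    (hG : G.IsHermitian) : G = 1 ∨ G = -1 := by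
  obtain ⟨c, hc, rfl⟩ := h
  have h1 : majoranaProd γ ∅ = 1 := by simp [majoranaProd]
  rw [h1] at hG ⊢
  have hs : Star.star c = c := by
    have := hG.eq
    rw [conjTranspose_smul, conjTranspose_one] at this
    exact smul_left_injective ℂ one_ne_zero this
  have hre : ((c.re : ℝ) : ℂ) = c := Complex.conj_eq_iff_re.1 hs
  have hr : c.re ^ 4 = 1 := by
    rw [← hre] at hc; exact_mod_cast hc
  have : (c.re ^ 2 - 1) * (c.re ^ 2 + 1) = 0 := by linear_combination hr
  have h2 : c.re ^ 2 = 1 := by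
    rcases mul_eq_zero.1 this with h | h
    · linarith
    · nlinarith [sq_nonneg c.re]
  rcases eq_or_eq_neg_of_sq_eq_sq c.re 1 (by rw [h2]; norm_num) with h | h
  · left; rw [← hre, h]; simp
  · right; rw [← hre, h]; simp

theorem IsMajorana.isString_pair (hγ : IsMajorana γ) {k l : Fin (2 * n)} (hkl : k ≠ l) :
    IsString γ {k, l} (Complex.I • (γ k * γ l)) := by
  have h := hγ.isString_prod (l := [k, l]) (by simp [hkl])
  simpa using h.smul (c := Complex.I) (by simp)

theorem IsMajorana.isHermitian_pair (hγ : IsMajorana γ) {k l : Fin (2 * n)} (hkl : k ≠ l) :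
    (Complex.I • (γ k * γ l)).IsHermitian := by
  rw [IsHermitian, conjTranspose_smul, conjTranspose_mul, (hγ.isHermitian k).eq,
    (hγ.isHermitian l).eq, hγ.anticomm l k hkl.symm]
  simp

theorem IsMajorana.pair_mul_self (hγ : IsMajorana γ) {k l : Fin (2 * n)} (hkl : k ≠ l) :
    (Complex.I • (γ k * γ l)) * (Complex.I • (γ k * γ l)) = 1 := by
  have := (hγ.isString_pair hkl).mul_conjTranspose hγ
  rwa [(hγ.isHermitian_pair hkl).eq] at this

end Strings

/-! ### The terms of the Hamiltonian as Hermitian strings -/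

section Terms

variable {n R d : ℕ} {ι : Type*} [Fintype ι] [DecidableEq ι] {γ : Fin (2 * n) → Matrix ι ι ℂ}

theorem FermionicHamiltonian.isString (H : FermionicHamiltonian n R d) (a : Fin H.m) :
    IsString γ (H.supp a) (H.G γ a) := by
  refine ⟨_, ?_, rfl⟩
  rw [mul_pow, ← pow_mul, mul_comm (_ / 2), pow_mul, Complex.I_pow_four, one_pow, mul_one]
  rcases Int.units_eq_one_or (H.sign a) with h | h <;> rw [h] <;> norm_num

theorem FermionicHamiltonian.isHermitian (hγ : IsMajorana γ) (H : FermionicHamiltonian n R d)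
    (a : Fin H.m) : (H.G γ a).IsHermitian := by
  obtain ⟨h, hh⟩ := H.supp_even a
  have hp : (majoranaProd γ (H.supp a))ᴴ =
      (-1 : ℂ) ^ (H.supp a).card.choose 2 • majoranaProd γ (H.supp a) := by
    rw [majoranaProd, hγ.conjTranspose_prod, hγ.prod_reverse (Finset.sort_nodup _ _),
      Finset.length_sort]
  have hs : Star.star (((H.sign a : ℤ) : ℂ)) = ((H.sign a : ℤ) : ℂ) := by simp
  have hc : (h + h).choose 2 = h * (2 * h - 1) := by
    rw [Nat.choose_two_right, ← two_mul, mul_assoc, Nat.mul_div_cancel_left _ two_pos]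
  -- Conjugating I ^ h gives (-1)^h and reversing 2h factors gives (-1)^(h(2h-1)); the exponents add
  -- up to 2h².
  have hI : (-1 : ℂ) ^ h * (-1) ^ (h * (2 * h - 1)) = 1 := by
    rw [← pow_add]
    refine Even.neg_one_pow ⟨h * h, ?_⟩
    rcases h with _ | h
    · rfl
    · rw [Nat.mul_sub]
      have : (h + 1) * (2 * (h + 1)) ≥ (h + 1) * 1 := Nat.mul_le_mul_left _ (by omega)
      have h3 : (h + 1) * (2 * (h + 1)) = (h + 1) * (h + 1) + (h + 1) * (h + 1) := by ring
      omega
  have h2 : (h + h) / 2 = h := by omega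
  rw [IsHermitian, FermionicHamiltonian.G, conjTranspose_smul, hp, smul_smul, hh, hc, h2, star_mul,
    hs, star_pow, Complex.star_def, Complex.conj_I, neg_pow]
  congr 1
  linear_combination (((H.sign a : ℤ) : ℂ) * Complex.I ^ h) * hI

end Terms

end HighTempFermion

namespace HighTempFermion

open Matrix

section Words

/-! ### Words -/

/-- The words of length `t` over a finite alphabet. -/
def words (α : Type*) [Fintype α] : ℕ → Finset (List α)
  | 0 => {[]}
  | t + 1 => (Finset.univ ×ˢ words α t).map
      ⟨fun p => p.1 :: p.2, fun p q h => by
        obtain ⟨h1, h2⟩ := List.cons.inj h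
        exact Prod.ext h1 h2⟩

theorem mem_words {α : Type*} [Fintype α] {t : ℕ} {w : List α} :
    w ∈ words α t ↔ w.length = t := by
  induction t generalizing w with
  | zero => simp [words]
  | succ t ih =>
    cases w with
    | nil => simp [words]
    | cons x w =>
      rw [words, Finset.mem_map, List.length_cons, Nat.add_right_cancel_iff, ← ih]
      constructor
      · rintro ⟨⟨y, v⟩, hv, h⟩
        obtain ⟨-, rfl⟩ := List.cons.inj h
        exact (Finset.mem_product.1 hv).2
      · exact fun hw => ⟨(x, w), Finset.mem_product.2 ⟨Finset.mem_univ _, hw⟩, rfl⟩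

theorem sum_words_succ {α M : Type*} [Fintype α] [AddCommMonoid M] (t : ℕ) (f : List α → M) :
    ∑ w ∈ words α (t + 1), f w = ∑ w ∈ words α t, ∑ x, f (x :: w) := by
  rw [words, Finset.sum_map, Finset.sum_product_right]
  rfl

variable {n R d : ℕ} {ι : Type*} [Fintype ι] [DecidableEq ι] {γ : Fin (2 * n) → Matrix ι ι ℂ}
  {H : FermionicHamiltonian n R d} {β N : ℝ} {S : Finset (Fin (2 * n))} {i : Fin (2 * n)}

/-- The term of the Hamiltonian to which a letter refers. -/
def letterTerm {m : ℕ} : Fin m ⊕ Fin m → Fin m := Sum.elim id id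

/-- The bound on the cardinality is weighed against the scale (NR)^{-t}; the last clause later
places the support inside the current set S. -/
theorem wordOp_isString (hγ : IsMajorana γ) (w : List (Fin H.m ⊕ Fin H.m)) :
    ∃ A, IsString γ A (wordOp H γ w) ∧ Even A.card ∧ A.card ≤ w.length * R ∧
      ∀ U, (∀ x ∈ w, H.supp (letterTerm x) ⊆ U) → A ⊆ U := by
  have hcard : ∀ A B : Finset (Fin (2 * n)), (symmDiff A B).card ≤ A.card + B.card := by
    intro A B
    exact (Finset.card_le_card symmDiff_le_sup).trans (Finset.card_union_le _ _)
  have hsub : ∀ A B U : Finset (Fin (2 * n)), A ⊆ U → B ⊆ U → symmDiff A B ⊆ U := by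
    intro A B U hA hB
    exact (symmDiff_le_sup (a := A) (b := B)).trans (Finset.union_subset hA hB)
  induction w with
  | nil => exact ⟨∅, isString_one, by simp, by simp, by simp⟩
  | cons x w ih =>
    obtain ⟨A, hA, hAe, hAc, hAU⟩ := ih
    cases x with
    | inl a =>
      refine ⟨symmDiff (H.supp a) A, (H.isString a).mul hγ hA,
        even_card_symmDiff (H.supp_even a) hAe, ?_, fun U hU => hsub _ _ _ ?_ ?_⟩
      · refine (hcard _ _).trans ?_
        have := H.supp_card_le a
        rw [List.length_cons, add_mul, one_mul]
        omega
      · exact hU _ List.mem_cons_self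
      · exact hAU U fun x hx => hU x (List.mem_cons_of_mem _ hx)
    | inr a =>
      refine ⟨symmDiff A (H.supp a), (hA.mul hγ (H.isString a)).neg,
        even_card_symmDiff hAe (H.supp_even a), ?_, fun U hU => hsub _ _ _ ?_ ?_⟩
      · refine (hcard _ _).trans ?_
        have := H.supp_card_le a
        rw [List.length_cons, add_mul, one_mul]
        omega
      · exact hAU U fun x hx => hU x (List.mem_cons_of_mem _ hx)
      · exact hU _ List.mem_cons_self

theorem wordCoeff_nonneg (hβ : 0 ≤ β) (w : List (Fin H.m ⊕ Fin H.m)) :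
    0 ≤ wordCoeff H γ β S i w := by
  induction w with
  | nil => simp [wordCoeff]
  | cons x w ih =>
    cases x with
    | inl a =>
      have := H.coeff_nonneg a
      simp only [wordCoeff]
      split_ifs <;> positivity
    | inr a =>
      have := H.coeff_nonneg a
      simp only [wordCoeff]
      split_ifs <;> positivity

theorem wordCoeff_cons_ne_zero {x : Fin H.m ⊕ Fin H.m} {w : List (Fin H.m ⊕ Fin H.m)}
    (h : wordCoeff H γ β S i (x :: w) ≠ 0) : wordCoeff H γ β S i w ≠ 0 := by
  intro h0
  cases x <;> simp [wordCoeff, h0] at h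

theorem wordCoeff_inl_ne_zero {a : Fin H.m} {w : List (Fin H.m ⊕ Fin H.m)}
    (h : wordCoeff H γ β S i (Sum.inl a :: w) ≠ 0) :
    H.supp a ⊆ S.erase i ∧ ¬ Commute (H.G γ a) (wordOp H γ w) := by
  by_contra h0
  simp [wordCoeff, h0] at h

theorem wordCoeff_inr_ne_zero {a : Fin H.m} {w : List (Fin H.m ⊕ Fin H.m)}
    (h : wordCoeff H γ β S i (Sum.inr a :: w) ≠ 0) : H.supp a ⊆ S ∧ i ∈ H.supp a := by
  by_contra h0
  simp [wordCoeff, h0] at h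

theorem supp_subset_of_wordCoeff_ne_zero {w : List (Fin H.m ⊕ Fin H.m)}
    (h : wordCoeff H γ β S i w ≠ 0) {x : Fin H.m ⊕ Fin H.m} (hx : x ∈ w) :
    H.supp (letterTerm x) ⊆ S := by
  induction w with
  | nil => simp at hx
  | cons y w ih =>
    rcases List.mem_cons.1 hx with rfl | hx
    · cases x with
      | inl a => exact (wordCoeff_inl_ne_zero h).1.trans (Finset.erase_subset _ _)
      | inr a => exact (wordCoeff_inr_ne_zero h).1
    · exact ih (wordCoeff_cons_ne_zero h) hx

theorem exists_overlap_of_not_commute (hγ : IsMajorana γ) {a : Fin H.m}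
    {w : List (Fin H.m ⊕ Fin H.m)} (h : ¬ Commute (H.G γ a) (wordOp H γ w)) :
    ∃ x ∈ w, ¬ Disjoint (H.supp a) (H.supp (letterTerm x)) := by
  by_contra! hd
  refine h ?_
  clear h
  induction w with
  | nil => exact Commute.one_right _
  | cons x w ih =>
    have h1 := ih fun y hy => hd y (List.mem_cons_of_mem _ hy)
    have h2 : Commute (H.G γ a) (H.G γ (letterTerm x)) :=
      (H.isString a).commute_of_disjoint hγ (H.isString _) (H.supp_even a)
        (hd x List.mem_cons_self)
    cases x with
    | inl b => exact h2.mul_right h1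
    | inr b => exact (h1.mul_right h2).neg_right

/-- A term that does not act on `i` and overlaps a word of nonzero weight overlaps one of its
letters other than itself. -/
theorem exists_overlap_ne (hγ : IsMajorana γ) {a : Fin H.m} {w : List (Fin H.m ⊕ Fin H.m)}
    (hw : wordCoeff H γ β S i w ≠ 0) (ha : i ∉ H.supp a)
    (h : ∃ x ∈ w, ¬ Disjoint (H.supp a) (H.supp (letterTerm x))) :
    ∃ x ∈ w, a ≠ letterTerm x ∧ ¬ Disjoint (H.supp a) (H.supp (letterTerm x)) := by
  induction w with
  | nil => simp at h
  | cons y w ih =>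
    have htail : (∃ x ∈ w, ¬ Disjoint (H.supp a) (H.supp (letterTerm x))) →
        ∃ x ∈ y :: w, a ≠ letterTerm x ∧ ¬ Disjoint (H.supp a) (H.supp (letterTerm x)) := by
      intro h'
      obtain ⟨x, hx, h⟩ := ih (wordCoeff_cons_ne_zero hw) h'
      exact ⟨x, List.mem_cons_of_mem _ hx, h⟩
    obtain ⟨x, hx, hd⟩ := h
    rcases List.mem_cons.1 hx with rfl | hx
    · by_cases hax : a = letterTerm x
      · cases x with
        -- When it was prepended on the left, this letter failed to commute with the tail, so the
        -- term already overlaps the tail. A right letter is excluded because its term acts on i.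
        | inl b =>
          obtain rfl : a = b := hax
          exact htail (exists_overlap_of_not_commute hγ (wordCoeff_inl_ne_zero hw).2)
        | inr b =>
          obtain rfl : a = b := hax
          exact absurd (wordCoeff_inr_ne_zero hw).2 ha
      · exact ⟨x, List.mem_cons_self, hax, hd⟩
    · exact htail ⟨x, hx, hd⟩

open Classical in
-- Each such term is a neighbour of some letter whose term is different from it, so a letter
-- accounts for d terms and not d + 1. With d + 1 the bound βd on the weight of all extensions would
-- not follow.
theorem card_left_letters_le (hγ : IsMajorana γ) {w : List (Fin H.m ⊕ Fin H.m)}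
    (hw : wordCoeff H γ β S i w ≠ 0) :
    (Finset.univ.filter fun a =>
      H.supp a ⊆ S.erase i ∧ ¬ Commute (H.G γ a) (wordOp H γ w)).card ≤ w.length * d := by
  have hsub : (Finset.univ.filter fun a =>
      H.supp a ⊆ S.erase i ∧ ¬ Commute (H.G γ a) (wordOp H γ w)) ⊆
      w.toFinset.biUnion fun x => Finset.univ.filter fun a =>
        a ≠ letterTerm x ∧ ¬ Disjoint (H.supp (letterTerm x)) (H.supp a) := by
    intro a ha
    simp only [Finset.mem_filter, Finset.mem_univ, true_and] at ha
    have hi : i ∉ H.supp a := fun hi => Finset.notMem_erase i S (ha.1 hi)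
    obtain ⟨x, hx, hne, hd⟩ :=
      exists_overlap_ne hγ hw hi (exists_overlap_of_not_commute hγ ha.2)
    simp only [Finset.mem_biUnion, List.mem_toFinset, Finset.mem_filter, Finset.mem_univ,
      true_and]
    exact ⟨x, hx, hne, fun h => hd h.symm⟩
  calc _ ≤ _ := Finset.card_le_card hsub
    _ ≤ w.toFinset.card * d := Finset.card_biUnion_le_card_mul _ _ _ fun x _ => by
        convert H.degree_le (letterTerm x)
    _ ≤ w.length * d := Nat.mul_le_mul_right _ (List.toFinset_card_le w)

open Classical in
-- Terms acting on i overlap pairwise, so all of them are one chosen term or its neighbours.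
theorem card_right_letters_le (H : FermionicHamiltonian n R d) (S : Finset (Fin (2 * n)))
    (i : Fin (2 * n)) :
    (Finset.univ.filter fun a => H.supp a ⊆ S ∧ i ∈ H.supp a).card ≤ d + 1 := by
  rcases Finset.eq_empty_or_nonempty (Finset.univ.filter fun a => H.supp a ⊆ S ∧ i ∈ H.supp a) with
    h | ⟨b, hb⟩
  · simp [h]
  · simp only [Finset.mem_filter, Finset.mem_univ, true_and] at hb
    have hsub : (Finset.univ.filter fun a => H.supp a ⊆ S ∧ i ∈ H.supp a) ⊆
        insert b (Finset.univ.filter fun a => a ≠ b ∧ ¬ Disjoint (H.supp b) (H.supp a)) := by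
      intro a ha
      simp only [Finset.mem_filter, Finset.mem_univ, true_and] at ha
      simp only [Finset.mem_insert, Finset.mem_filter, Finset.mem_univ, true_and]
      by_cases hab : a = b
      · exact .inl hab
      · exact .inr ⟨hab, Finset.not_disjoint_iff.2 ⟨i, hb.2, ha.2⟩⟩
    refine (Finset.card_le_card hsub).trans ((Finset.card_insert_le _ _).trans ?_)
    have := H.degree_le b
    gcongr

/-- With e = β/(2(t+1)), at most td left letters contribute 2e each and at most d + 1 right letters
contribute e each. Since d ≥ 1, 2td + d + 1 ≤ 2(t+1)d, and the growth in t cancels the denominator.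
-/
theorem sum_wordCoeff_cons_le (hγ : IsMajorana γ) (hβ : 0 ≤ β) (w : List (Fin H.m ⊕ Fin H.m)) :
    ∑ x, wordCoeff H γ β S i (x :: w) ≤ β * d * wordCoeff H γ β S i w := by
  classical
  by_cases hw : wordCoeff H γ β S i w = 0
  · have : ∀ x, wordCoeff H γ β S i (x :: w) = 0 := fun x => by
      by_contra h
      exact wordCoeff_cons_ne_zero h hw
    simp [this, hw]
  set c := wordCoeff H γ β S i w with hc
  have hc0 : 0 ≤ c := wordCoeff_nonneg hβ w
  set e : ℝ := β / (2 * (w.length + 1)) with he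
  have he0 : 0 ≤ e := by positivity
  have hL : ∑ a, wordCoeff H γ β S i (Sum.inl a :: w) ≤ (w.length * d : ℕ) * (e * (2 * c)) := by
    simp only [wordCoeff]
    rw [← Finset.sum_filter]
    calc _ ≤ ∑ a ∈ Finset.univ.filter (fun a => H.supp a ⊆ S.erase i ∧
          ¬ Commute (H.G γ a) (wordOp H γ w)), e * (2 * c) := by
          refine Finset.sum_le_sum fun a _ => ?_
          have := H.coeff_le_one a
          have h1 := H.coeff_nonneg a
          rw [← hc, ← he]
          refine mul_le_mul_of_nonneg_left (mul_le_mul_of_nonneg_right ?_ hc0) he0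
          linarith
      _ ≤ _ := by
          rw [Finset.sum_const, nsmul_eq_mul]
          refine mul_le_mul_of_nonneg_right ?_ (by positivity)
          exact_mod_cast card_left_letters_le hγ hw
  have hR : ∑ a, wordCoeff H γ β S i (Sum.inr a :: w) ≤ (d + 1 : ℕ) * (e * c) := by
    simp only [wordCoeff]
    rw [← Finset.sum_filter]
    calc _ ≤ ∑ a ∈ Finset.univ.filter (fun a => H.supp a ⊆ S ∧ i ∈ H.supp a), e * c := by
          refine Finset.sum_le_sum fun a _ => ?_
          have := H.coeff_le_one a
          have h1 := H.coeff_nonneg a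
          rw [← hc, ← he]
          refine mul_le_mul_of_nonneg_left ?_ he0
          nlinarith
      _ ≤ _ := by
          rw [Finset.sum_const, nsmul_eq_mul]
          refine mul_le_mul_of_nonneg_right ?_ (by positivity)
          exact_mod_cast card_right_letters_le H S i
  rw [Fintype.sum_sum_type]
  have hd : (1 : ℝ) ≤ d := by exact_mod_cast H.one_le_degree
  have hee : e * (2 * (w.length + 1)) = β := by rw [he]; field_simp
  calc _ ≤ (w.length * d : ℕ) * (e * (2 * c)) + (d + 1 : ℕ) * (e * c) := add_le_add hL hR
    _ = (e * c) * (2 * w.length * d + d + 1) := by push_cast; ring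
    _ ≤ (e * c) * (2 * w.length * d + d + d) := by gcongr
    _ = β * d * c := by rw [← hee]; ring

theorem sum_words_weight_le (hγ : IsMajorana γ) (hβ : 0 ≤ β) (hN : 0 ≤ N)
    (hβN : β * d * (N * R) ≤ 1 / 2) (t : ℕ) :
    ∑ w ∈ words (Fin H.m ⊕ Fin H.m) t, wordCoeff H γ β S i w * (N * R) ^ w.length ≤
      (1 / 2) ^ t := by
  induction t with
  | zero => simp [words, wordCoeff]
  | succ t ih =>
    rw [sum_words_succ]
    calc _ ≤ ∑ w ∈ words (Fin H.m ⊕ Fin H.m) t,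
          1 / 2 * (wordCoeff H γ β S i w * (N * R) ^ w.length) := by
          refine Finset.sum_le_sum fun w _ => ?_
          simp only [List.length_cons]
          rw [← Finset.sum_mul]
          have h1 := sum_wordCoeff_cons_le (S := S) (i := i) hγ hβ w
          have h0 := wordCoeff_nonneg (S := S) (i := i) (γ := γ) hβ w
          calc _ ≤ β * d * wordCoeff H γ β S i w * (N * R) ^ (w.length + 1) := by gcongr
            _ = (β * d * (N * R)) * (wordCoeff H γ β S i w * (N * R) ^ w.length) := by ring
            _ ≤ _ := by gcongr
      _ ≤ 1 / 2 * (1 / 2) ^ t := by rw [← Finset.mul_sum]; gcongr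
      _ = _ := by ring

/-- Geometric domination by length. The total 2 includes weight 1 for the empty word, which leaves
at most 1 for the nonempty words: exactly what a probability distribution needs. -/
theorem summable_weight_and_tsum_le (hγ : IsMajorana γ) (hβ : 0 ≤ β) (hN : 0 ≤ N)
    (hβN : β * d * (N * R) ≤ 1 / 2) :
    Summable (fun w => wordCoeff H γ β S i w * (N * R) ^ w.length) ∧
      ∑' w, wordCoeff H γ β S i w * (N * R) ^ w.length ≤ 2 := by
  classical
  have h0 : ∀ w, 0 ≤ wordCoeff H γ β S i w * (N * R) ^ w.length := fun w =>
    mul_nonneg (wordCoeff_nonneg hβ w) (by positivity)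
  have hb : ∀ u : Finset (List (Fin H.m ⊕ Fin H.m)),
      ∑ w ∈ u, wordCoeff H γ β S i w * (N * R) ^ w.length ≤ 2 := by
    intro u
    have hu : u ⊆ (Finset.range (u.sup List.length + 1)).biUnion (words _) := by
      intro w hw
      simp only [Finset.mem_biUnion, Finset.mem_range, mem_words]
      exact ⟨_, Nat.lt_succ_of_le (Finset.le_sup (f := List.length) hw), rfl⟩
    refine (Finset.sum_le_sum_of_subset_of_nonneg hu fun w _ _ => h0 w).trans ?_
    rw [Finset.sum_biUnion]
    · calc _ ≤ ∑ t ∈ Finset.range (u.sup List.length + 1), (1 / 2 : ℝ) ^ t :=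
            Finset.sum_le_sum fun t _ => sum_words_weight_le hγ hβ hN hβN t
        _ ≤ ∑' t : ℕ, (1 / 2 : ℝ) ^ t :=
            summable_geometric_two.sum_le_tsum _ fun t _ => by positivity
        _ = 2 := tsum_geometric_two
    · intro s _ t _ hst
      refine Finset.disjoint_left.2 fun w hs ht => hst ?_
      rw [mem_words] at hs ht
      omega
  exact ⟨summable_of_sum_le h0 hb, Real.tsum_le_of_sum_le h0 hb⟩

theorem _root_.ENNReal.tsum_subtype_ne_add {α : Type*} (g : α → ℝ≥0∞) (a : α) :
    ∑' v : {v : α // v ≠ a}, g v.1 + g a = ∑' v, g v := by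
  have h := Summable.tsum_add_tsum_compl (f := g) (s := {v | v ≠ a}) ENNReal.summable
    ENNReal.summable
  have hc : ({v : α | v ≠ a})ᶜ = {a} := by ext; simp
  rw [hc, tsum_singleton a g] at h
  exact h

theorem _root_.ENNReal.tsum_subtype_ne_ofReal_le_one {α : Type*} {f : α → ℝ} (h0 : ∀ v, 0 ≤ f v)
    (hs : Summable f) (ht : ∑' v, f v ≤ 2) {a : α} (ha : f a = 1) :
    ∑' v : {v : α // v ≠ a}, ENNReal.ofReal (f v.1) ≤ 1 := by
  have hsplit := ENNReal.tsum_subtype_ne_add (fun w => ENNReal.ofReal (f w)) a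
  rw [← ENNReal.ofReal_tsum_of_nonneg h0 hs, ha, ENNReal.ofReal_one] at hsplit
  have h2 : ENNReal.ofReal (∑' w, f w) ≤ 1 + 1 := by
    rw [one_add_one_eq_two]
    simpa using ENNReal.ofReal_le_ofReal ht
  rw [← hsplit] at h2
  exact (ENNReal.add_le_add_iff_right ENNReal.one_ne_top).1 h2

theorem tsum_nonempty_weight_le (hγ : IsMajorana γ) (hβ : 0 ≤ β) (hN : 0 ≤ N)
    (hβN : β * d * (N * R) ≤ 1 / 2) :
    ∑' v : {v : List (Fin H.m ⊕ Fin H.m) // v ≠ []},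
      ENNReal.ofReal (wordCoeff H γ β S i v.1 * (N * R) ^ v.1.length) ≤ 1 := by
  obtain ⟨hs, ht⟩ := summable_weight_and_tsum_le (H := H) (S := S) (i := i) hγ hβ hN hβN
  exact ENNReal.tsum_subtype_ne_ofReal_le_one
    (f := fun w => wordCoeff H γ β S i w * (N * R) ^ w.length)
    (fun w => mul_nonneg (wordCoeff_nonneg hβ w) (by positivity)) hs ht (by simp [wordCoeff])

theorem tsum_wordProb (hγ : IsMajorana γ) (hβ : 0 ≤ β) (hN : 0 ≤ N)
    (hβN : β * d * (N * R) ≤ 1 / 2) : ∑' w, wordProb H γ β N S i w = 1 := by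
  have hle := tsum_nonempty_weight_le (H := H) (S := S) (i := i) hγ hβ hN hβN
  rw [← ENNReal.tsum_subtype_ne_add _ []]
  have h1 : ∑' v : {v : List (Fin H.m ⊕ Fin H.m) // v ≠ []}, wordProb H γ β N S i v.1 =
      ∑' v : {v : List (Fin H.m ⊕ Fin H.m) // v ≠ []},
        ENNReal.ofReal (wordCoeff H γ β S i v.1 * (N * R) ^ v.1.length) :=
    tsum_congr fun v => by rw [wordProb, if_neg v.2]
  rw [h1, wordProb, if_pos rfl]
  exact add_tsub_cancel_of_le hle

theorem wordPMF_apply (hγ : IsMajorana γ) (hβ : 0 ≤ β) (hN : 0 ≤ N)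
    (hβN : β * d * (N * R) ≤ 1 / 2) (w : List (Fin H.m ⊕ Fin H.m)) :
    wordPMF H γ β N S i w = wordProb H γ β N S i w := by
  have h : wordPMF H γ β N S i =
      ⟨wordProb H γ β N S i, tsum_wordProb hγ hβ hN hβN ▸ ENNReal.summable.hasSum⟩ :=
    dif_pos (tsum_wordProb hγ hβ hN hβN)
  rw [h]
  rfl

end Words

end HighTempFermion

namespace HighTempFermion

open Matrix
open scoped Matrix.Norms.L2Operator

/-! ### The expectation of a sampled factor -/

section ExpSeries

variable {𝔸 : Type*} [NormedRing 𝔸] [NormedAlgebra ℝ 𝔸]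

/-- The part of degree `t` of the series of `exp X * exp Y`. -/
noncomputable def expMulTerm (X Y : 𝔸) (t : ℕ) : 𝔸 :=
  ∑ p ∈ Finset.HasAntidiagonal.antidiagonal t,
    ((p.1.factorial : ℝ)⁻¹ • X ^ p.1) * ((p.2.factorial : ℝ)⁻¹ • Y ^ p.2)

theorem hasSum_expMulTerm [CompleteSpace 𝔸] (X Y : 𝔸) :
    HasSum (expMulTerm X Y) (NormedSpace.exp X * NormedSpace.exp Y) := by
  have hX := NormedSpace.norm_expSeries_summable' (𝕂 := ℝ) X
  have hY := NormedSpace.norm_expSeries_summable' (𝕂 := ℝ) Y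
  have h := tsum_mul_tsum_eq_tsum_sum_antidiagonal_of_summable_norm hX hY
  rw [(NormedSpace.exp_series_hasSum_exp' (𝕂 := ℝ) X).tsum_eq,
    (NormedSpace.exp_series_hasSum_exp' (𝕂 := ℝ) Y).tsum_eq] at h
  rw [h]
  exact (summable_norm_sum_mul_antidiagonal_of_summable_norm hX hY).of_norm.hasSum

/-- Coefficient form of the differential equation F' = XF + FY satisfied by F(s) = e^{sX} e^{sY}. -/
theorem succ_smul_expMulTerm (X Y : 𝔸) (t : ℕ) :
    ((t : ℝ) + 1) • expMulTerm X Y (t + 1) = X * expMulTerm X Y t + expMulTerm X Y t * Y := by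
  have hX : ∀ (Z : 𝔸) (k : ℕ), ((k : ℝ) + 1) • (((k + 1).factorial : ℝ)⁻¹ • Z ^ (k + 1)) =
      Z * ((k.factorial : ℝ)⁻¹ • Z ^ k) := by
    intro Z k
    rw [smul_smul, mul_smul_comm, ← pow_succ', Nat.factorial_succ]
    congr 1
    push_cast
    field_simp
  have hY : ∀ (Z : 𝔸) (k : ℕ), ((k : ℝ) + 1) • (((k + 1).factorial : ℝ)⁻¹ • Z ^ (k + 1)) =
      ((k.factorial : ℝ)⁻¹ • Z ^ k) * Z := by
    intro Z k
    rw [hX, mul_smul_comm, smul_mul_assoc, ← pow_succ, ← pow_succ']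
  have h1 : ((t : ℝ) + 1) • expMulTerm X Y (t + 1) =
      ∑ p ∈ Finset.HasAntidiagonal.antidiagonal (t + 1), (p.1 : ℝ) •
        (((p.1.factorial : ℝ)⁻¹ • X ^ p.1) * ((p.2.factorial : ℝ)⁻¹ • Y ^ p.2)) +
      ∑ p ∈ Finset.HasAntidiagonal.antidiagonal (t + 1), (p.2 : ℝ) •
        (((p.1.factorial : ℝ)⁻¹ • X ^ p.1) * ((p.2.factorial : ℝ)⁻¹ • Y ^ p.2)) := by
    rw [expMulTerm, Finset.smul_sum, ← Finset.sum_add_distrib]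
    refine Finset.sum_congr rfl fun p hp => ?_
    rw [← add_smul]
    congr 1
    exact_mod_cast (Finset.HasAntidiagonal.mem_antidiagonal.1 hp).symm
  rw [h1, Finset.Nat.sum_antidiagonal_succ, Finset.Nat.sum_antidiagonal_succ']
  simp only [Nat.cast_zero, zero_smul, zero_add]
  rw [expMulTerm, Finset.mul_sum, Finset.sum_mul]
  congr 1
  · refine Finset.sum_congr rfl fun p _ => ?_
    rw [← smul_mul_assoc, Nat.cast_add, Nat.cast_one, hX, mul_assoc]
  · refine Finset.sum_congr rfl fun p _ => ?_
    rw [← mul_smul_comm, Nat.cast_add, Nat.cast_one, hY, mul_assoc]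

end ExpSeries

/-! ### The word series of the factor M and the mean of its sample -/

section Sampling

variable {n R d : ℕ} {ι : Type*} [Fintype ι] [DecidableEq ι] {γ : Fin (2 * n) → Matrix ι ι ℂ}
  {H : FermionicHamiltonian n R d} {β N : ℝ} {S : Finset (Fin (2 * n))} {i : Fin (2 * n)}

theorem IsString.norm_le_one [Nonempty ι] (hγ : IsMajorana γ) {A : Finset (Fin (2 * n))}
    {G : Matrix ι ι ℂ} (h : IsString γ A G) : ‖G‖ ≤ 1 := by
  have h1 := l2_opNorm_conjTranspose_mul_self G
  rw [h.mul_conjTranspose hγ, CStarRing.norm_one] at h1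
  nlinarith [norm_nonneg G]

/-- Compare term by term. A term inside S that avoids i enters through GW - WG, which is 0 or 2GW as
strings commute or anticommute; this is the origin of the factor 2 on left letters. A term through i
occurs only in H^S and gives -WG. -/
theorem succ_smul_sum_cons (hγ : IsMajorana γ) (w : List (Fin H.m ⊕ Fin H.m)) :
    ((w.length : ℝ) + 1) • ∑ x, wordCoeff H γ β S i (x :: w) • wordOp H γ (x :: w) =
      ((β / 2) • H.restrict γ (S.erase i)) * (wordCoeff H γ β S i w • wordOp H γ w) +
        (wordCoeff H γ β S i w • wordOp H γ w) * -((β / 2) • H.restrict γ S) := by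
  classical
  set c := wordCoeff H γ β S i w with hc
  set W := wordOp H γ w with hW
  have ht : (w.length : ℝ) + 1 ≠ 0 := by positivity
  rw [Fintype.sum_sum_type, ← Finset.sum_add_distrib, FermionicHamiltonian.restrict,
    FermionicHamiltonian.restrict, Finset.sum_filter, Finset.sum_filter, Finset.smul_sum,
    Finset.smul_sum, Finset.smul_sum, Finset.sum_mul, ← Finset.sum_neg_distrib, Finset.mul_sum,
    ← Finset.sum_add_distrib]
  refine Finset.sum_congr rfl fun a _ => ?_
  simp only [wordCoeff, wordOp, ← hc, ← hW, Finset.subset_erase]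
  set G := H.G γ a with hG
  have e1 : ((w.length : ℝ) + 1) * (β / (2 * ((w.length : ℝ) + 1)) * (2 * H.coeff a * c)) =
      β / 2 * (2 * H.coeff a * c) := by field_simp
  have e2 : ((w.length : ℝ) + 1) * (β / (2 * ((w.length : ℝ) + 1)) * (H.coeff a * c)) =
      β / 2 * (H.coeff a * c) := by field_simp
  by_cases hS : H.supp a ⊆ S
  · by_cases hi : i ∈ H.supp a
    · simp only [hS, hi, not_true_eq_false, and_false, false_and, if_false, if_true, zero_smul,
        zero_add, and_self, smul_zero, zero_mul, smul_smul]
      rw [e2]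
      simp only [smul_neg, mul_neg, smul_mul_assoc, mul_smul_comm, smul_smul]
      congr 2
      ring
    · by_cases hcomm : Commute G W
      · simp only [hS, hi, hcomm, not_true_eq_false, not_false_eq_true, and_false, and_true,
          if_false, if_true, zero_smul, zero_add, smul_zero]
        simp only [mul_neg, smul_mul_assoc, mul_smul_comm, hcomm.eq]
        rw [smul_comm c, smul_comm c, add_neg_cancel]
      · have hanti : W * G = -(G * W) := by
          obtain ⟨A, hA, -⟩ := wordOp_isString hγ w
          have h := ((H.isString a).commute_or_anticommute hγ hA).resolve_left hcomm
          rw [← hG, ← hW] at h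
          rw [h, neg_neg]
        simp only [hS, hi, hcomm, not_false_eq_true, and_false, and_self, if_false,
          if_true, zero_smul, add_zero, smul_smul]
        rw [e1]
        simp only [mul_neg, smul_mul_assoc, mul_smul_comm, smul_smul, hanti, smul_neg, neg_neg]
        rw [← add_smul]
        congr 1
        ring
  · simp [hS]

theorem sum_words_eq_expMulTerm (hγ : IsMajorana γ) (t : ℕ) :
    ∑ w ∈ words (Fin H.m ⊕ Fin H.m) t, wordCoeff H γ β S i w • wordOp H γ w =
      expMulTerm ((β / 2) • H.restrict γ (S.erase i)) (-((β / 2) • H.restrict γ S)) t := by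
  induction t with
  | zero => simp [words, wordCoeff, wordOp, expMulTerm]
  | succ t ih =>
    have ht : (t : ℝ) + 1 ≠ 0 := by positivity
    apply smul_right_injective _ ht
    simp only
    rw [succ_smul_expMulTerm, ← ih, sum_words_succ, Finset.smul_sum, Finset.mul_sum,
      Finset.sum_mul, ← Finset.sum_add_distrib]
    refine Finset.sum_congr rfl fun w hw => ?_
    rw [← mem_words.1 hw]
    exact succ_smul_sum_cons hγ w

/-- Strings have norm at most 1 and NR ≥ 1, so the rescaled weights dominate the series. Absolute
convergence permits regrouping by word length into the series of the product of exponentials. -/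
theorem hasSum_wordCoeff_smul_wordOp [Nonempty ι] (hγ : IsMajorana γ) (hβ : 0 ≤ β)
    (hNR : 1 ≤ N * R) (hN : 0 ≤ N) (hβN : β * d * (N * R) ≤ 1 / 2) :
    HasSum (fun w => wordCoeff H γ β S i w • wordOp H γ w) (H.factor γ β S i) := by
  have hs : Summable (fun w => wordCoeff H γ β S i w • wordOp H γ w) := by
    refine Summable.of_norm_bounded
      (summable_weight_and_tsum_le (H := H) (S := S) (i := i) hγ hβ hN hβN).1 fun w => ?_
    obtain ⟨A, hA, -⟩ := wordOp_isString (H := H) hγ w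
    have h0 := wordCoeff_nonneg (S := S) (i := i) (γ := γ) hβ w
    rw [norm_smul, Real.norm_of_nonneg h0]
    exact mul_le_mul_of_nonneg_left ((hA.norm_le_one hγ).trans (one_le_pow₀ hNR)) h0
  have h1 := hs.hasSum.tsum_fiberwise List.length
  have h2 : ∀ t, List.length ⁻¹' {t} =
      ((words (Fin H.m ⊕ Fin H.m) t : Finset (List (Fin H.m ⊕ Fin H.m)))
      : Set (List (Fin H.m ⊕ Fin H.m))) := by
    intro t; ext w; simp [mem_words]
  have h3 : (fun t => ∑' w : (List.length ⁻¹' {t} : Set (List (Fin H.m ⊕ Fin H.m))),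
      wordCoeff H γ β S i w.1 • wordOp H γ w.1) =
      expMulTerm ((β / 2) • H.restrict γ (S.erase i)) (-((β / 2) • H.restrict γ S)) := by
    funext t
    rw [h2, Finset.tsum_subtype' _ fun w => wordCoeff H γ β S i w • wordOp H γ w]
    exact sum_words_eq_expMulTerm hγ t
  rw [h3] at h1
  have h4 := h1.unique (hasSum_expMulTerm _ _)
  rw [FermionicHamiltonian.factor, ← h4]
  exact hs.hasSum

theorem PMF.hasSum_toReal {α : Type*} (p : PMF α) : HasSum (fun x => (p x).toReal) 1 := by
  have h := ENNReal.hasSum_toReal (f := p) (by rw [p.tsum_coe]; exact ENNReal.one_ne_top)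
  have h1 := ENNReal.tsum_toReal_eq (f := p) p.apply_ne_top
  rw [p.tsum_coe, ENNReal.toReal_one] at h1
  rwa [← h1] at h

theorem hasSum_wordPMF [Nonempty ι] (hγ : IsMajorana γ) (hβ : 0 ≤ β)
    (hNR : 1 ≤ N * R) (hN : 0 ≤ N) (hβN : β * d * (N * R) ≤ 1 / 2) :
    HasSum (fun w => (wordPMF H γ β N S i w).toReal •
      (1 + sampledScale H N w • sampledString H γ w)) (H.factor γ β S i) := by
  classical
  have h1 := (PMF.hasSum_toReal (wordPMF H γ β N S i)).smul_const (1 : Matrix ι ι ℂ)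
  have h2 := hasSum_wordCoeff_smul_wordOp (H := H) (S := S) (i := i) hγ hβ hNR hN hβN
  have h3 := hasSum_ite_eq ([] : List (Fin H.m ⊕ Fin H.m)) (1 : Matrix ι ι ℂ)
  -- The probabilities sum to one identity and the word series to M. The empty word of that series
  -- is also the identity, whereas its sampled string is 0, so one identity is removed at `[]`.
  have h4 := (h1.add h2).sub h3
  rw [one_smul, add_sub_cancel_left] at h4
  refine Eq.subst (motive := fun f => HasSum f (H.factor γ β S i)) (funext fun w => ?_) h4
  symm
  rw [wordPMF_apply hγ hβ hN hβN, sampledScale, sampledString]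
  by_cases hw : w = []
  · simp [hw, wordCoeff, wordOp]
  · have h0 := wordCoeff_nonneg (S := S) (i := i) (γ := γ) hβ w
    have hNR' : (N * R) ^ w.length ≠ 0 := pow_ne_zero _ (by linarith)
    rw [if_neg hw, if_neg hw, sub_zero, smul_add, wordProb, if_neg hw,
      ENNReal.toReal_ofReal (by positivity), smul_smul, mul_assoc, mul_inv_cancel₀ hNR', mul_one]

end Sampling

end HighTempFermion

namespace HighTempFermion

/-! ### Expectations over discrete distributions -/

section Mean

variable {α β E : Type*} [NormedAddCommGroup E] [NormedSpace ℝ E]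

/-- The expectation of `f` under `p` converges unconditionally to `v`. -/
def HasMean (p : PMF α) (f : α → E) (v : E) : Prop := HasSum (fun x => (p x).toReal • f x) v

theorem hasMean_pure (a : α) (f : α → E) : HasMean (PMF.pure a) f (f a) := by
  have h : (fun x => ((PMF.pure a) x).toReal • f x) a = f a := by simp
  rw [HasMean, ← h]
  exact hasSum_single a fun b hb => by simp [PMF.pure_apply, hb]

theorem HasMean.congr {p : PMF α} {f g : α → E} {v : E} (h : HasMean p f v)
    (hfg : ∀ a ∈ p.support, f a = g a) : HasMean p g v := by
  have : (fun x => (p x).toReal • f x) = fun x => (p x).toReal • g x := by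
    funext x
    by_cases hx : p x = 0
    · simp [hx]
    · rw [hfg x ((p.mem_support_iff x).2 hx)]
  rwa [HasMean, ← this]

/-- Fubini over pairs: the bound on f over the reachable points gives absolute summability, and the
double series is then summed in either order. -/
theorem HasMean.bind [CompleteSpace E] {p : PMF α} {q : α → PMF β} {f : β → E} {g : α → E} {v : E}
    {C : ℝ} (hC : ∀ a ∈ p.support, ∀ b ∈ (q a).support, ‖f b‖ ≤ C)
    (hq : ∀ a ∈ p.support, HasMean (q a) f (g a)) (hp : HasMean p g v) :
    HasMean (p.bind q) f v := by
  set F : α × β → E := fun x => ((p x.1).toReal * (q x.1 x.2).toReal) • f x.2 with hF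
  have hbound : ∀ x, ‖F x‖ ≤ (p x.1).toReal * (q x.1 x.2).toReal * |C| := by
    rintro ⟨a, b⟩
    rw [hF, norm_smul, Real.norm_of_nonneg (by positivity)]
    by_cases ha : p a = 0
    · simp [ha]
    by_cases hb : q a b = 0
    · simp [hb]
    gcongr
    exact (hC a ((p.mem_support_iff a).2 ha) b (((q a).mem_support_iff b).2 hb)).trans
      (le_abs_self C)
  have hG : Summable fun x : α × β => (p x.1).toReal * (q x.1 x.2).toReal * |C| := by
    have h1 : ∀ a, HasSum (fun b => (p a).toReal * (q a b).toReal * |C|) ((p a).toReal * |C|) := by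
      intro a
      simpa using ((PMF.hasSum_toReal (q a)).mul_left (p a).toReal).mul_right |C|
    refine (summable_prod_of_nonneg fun x => by positivity).2 ⟨fun a => (h1 a).summable, ?_⟩
    have h2 : (fun a => ∑' b, (p a).toReal * (q a b).toReal * |C|) =
        fun a => (p a).toReal * |C| := funext fun a => (h1 a).tsum_eq
    simp only [h2]
    exact (PMF.hasSum_toReal p).summable.mul_right _
  have hS : Summable F := Summable.of_norm_bounded hG hbound
  have h1 : HasSum (fun a => (p a).toReal • g a) (∑' x, F x) := by
    refine hS.hasSum.prod_fiberwise fun a => ?_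
    by_cases ha : p a = 0
    · simp [hF, ha]
    · simpa [hF, mul_smul] using
        (hq a ((p.mem_support_iff a).2 ha)).const_smul (p a).toReal
  have hv : ∑' x, F x = v := h1.unique hp
  have h2 : HasSum (F ∘ Equiv.prodComm β α) v := by
    rw [Equiv.hasSum_iff, ← hv]
    exact hS.hasSum
  refine h2.prod_fiberwise fun b => ?_
  have h3 : HasSum (fun a => (p a).toReal * (q a b).toReal) ((p.bind q) b).toReal := by
    rw [PMF.bind_apply]
    have hne : ∑' a, p a * q a b ≠ ⊤ := by
      rw [← PMF.bind_apply]
      exact (p.bind q).apply_ne_top b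
    have h4 := ENNReal.hasSum_toReal hne
    rw [← ENNReal.tsum_toReal_eq fun a =>
      ENNReal.mul_ne_top (p.apply_ne_top a) ((q a).apply_ne_top b)] at h4
    simpa [ENNReal.toReal_mul] using h4
  exact h3.smul_const (f b)

theorem HasMean.bind₃ [CompleteSpace E] {δ ε : Type*} {p₁ : PMF α} {p₂ : PMF β} {p₃ : PMF δ}
    {q : α → β → δ → PMF ε} {f : ε → E} {g₃ : α → β → δ → E} {g₂ : α → β → E} {g₁ : α → E} {v : E}
    {C : ℝ}
    (hC : ∀ y ∈ (p₁.bind fun a => p₂.bind fun b => p₃.bind fun c => q a b c).support, ‖f y‖ ≤ C)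
    (hq : ∀ a ∈ p₁.support, ∀ b ∈ p₂.support, ∀ c, HasMean (q a b c) f (g₃ a b c))
    (h₃ : ∀ a ∈ p₁.support, ∀ b ∈ p₂.support, HasMean p₃ (g₃ a b) (g₂ a b))
    (h₂ : ∀ a ∈ p₁.support, HasMean p₂ (g₂ a) (g₁ a)) (h₁ : HasMean p₁ g₁ v) :
    HasMean (p₁.bind fun a => p₂.bind fun b => p₃.bind fun c => q a b c) f v := by
  simp only [PMF.mem_support_bind_iff] at hC
  refine HasMean.bind (C := C) (fun a ha y hy => hC y ?_) (fun a ha => ?_) h₁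
  · exact ⟨a, ha, by simpa only [PMF.mem_support_bind_iff] using hy⟩
  refine HasMean.bind (C := C) (fun b hb y hy => hC y ?_) (fun b hb => ?_) (h₂ a ha)
  · exact ⟨a, ha, b, hb, by simpa only [PMF.mem_support_bind_iff] using hy⟩
  refine HasMean.bind (C := C) (fun c hc y hy => hC y ?_) (fun c _ => hq a ha b hb c) (h₃ a ha b hb)
  exact ⟨a, ha, b, hb, c, hc, hy⟩

theorem HasMean.map [CompleteSpace E] {p : PMF α} {g : α → β} {f : β → E} {v : E} {C : ℝ}
    (hC : ∀ a ∈ p.support, ‖f (g a)‖ ≤ C) (hp : HasMean p (fun a => f (g a)) v) :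
    HasMean (p.map g) f v := by
  refine HasMean.bind (C := C) (fun a ha b hb => ?_) (fun a _ => hasMean_pure _ _) hp
  simp only [Function.comp_apply, PMF.support_pure, Set.mem_singleton_iff] at hb
  rw [hb]
  exact hC a ha

theorem HasMean.map_of_fintype [CompleteSpace E] [Fintype α] {p : PMF α} {g : α → β} {f : β → E}
    {v : E} (hp : HasMean p (fun a => f (g a)) v) : HasMean (p.map g) f v :=
  HasMean.map (C := ∑ a, ‖f (g a)‖) (fun a _ => Finset.single_le_sum (f := fun a => ‖f (g a)‖)
    (fun _ _ => norm_nonneg _) (Finset.mem_univ a)) hp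

theorem hasMean_fintype [Fintype α] (p : PMF α) (f : α → E) :
    HasMean p f (∑ a, (p a).toReal • f a) := hasSum_fintype _

theorem HasMean.mapL {F : Type*} [NormedAddCommGroup F] [NormedSpace ℝ F] {p : PMF α} {f : α → E}
    {v : E} (h : HasMean p f v) (Φ : E →L[ℝ] F) : HasMean p (fun a => Φ (f a)) (Φ v) := by
  have := Φ.hasSum h
  simpa [HasMean] using this

end Mean

end HighTempFermion

namespace HighTempFermion

open Matrix
open scoped Matrix.Norms.L2Operator

/-! ### One iteration of the algorithm in expectation -/

section Martingale

variable {n R d : ℕ} {ι : Type*} [Fintype ι] [DecidableEq ι] {γ : Fin (2 * n) → Matrix ι ι ℂ}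
  {H : FermionicHamiltonian n R d} {β N : ℝ}

theorem FermionicHamiltonian.isHermitian_restrict (hγ : IsMajorana γ)
    (H : FermionicHamiltonian n R d) (S : Finset (Fin (2 * n))) :
    (H.restrict γ S).IsHermitian := by
  rw [IsHermitian, FermionicHamiltonian.restrict, conjTranspose_sum]
  refine Finset.sum_congr rfl fun a _ => ?_
  rw [conjTranspose_smul, (H.isHermitian hγ a).eq, star_trivial]

/-- The square root `e^{-β H^S / 2}` of the Boltzmann factor of `H^S`. -/
noncomputable def FermionicHamiltonian.halfBoltzmann (H : FermionicHamiltonian n R d)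
    (γ : Fin (2 * n) → Matrix ι ι ℂ) (β : ℝ) (S : Finset (Fin (2 * n))) : Matrix ι ι ℂ :=
  NormedSpace.exp (-((β / 2) • H.restrict γ S))

theorem FermionicHamiltonian.isHermitian_halfBoltzmann (hγ : IsMajorana γ)
    (H : FermionicHamiltonian n R d) (β : ℝ) (S : Finset (Fin (2 * n))) :
    (H.halfBoltzmann γ β S).IsHermitian := by
  refine IsHermitian.exp ?_
  rw [IsHermitian, conjTranspose_neg, conjTranspose_smul, (H.isHermitian_restrict hγ S).eq,
    star_trivial]

/-- The telescoping identity E_{S'} M = E_S: the left exponential of the factor cancels E_{S'}. -/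
theorem FermionicHamiltonian.halfBoltzmann_erase_mul_factor (H : FermionicHamiltonian n R d)
    (β : ℝ) (S : Finset (Fin (2 * n))) (i : Fin (2 * n)) :
    H.halfBoltzmann γ β (S.erase i) * H.factor γ β S i = H.halfBoltzmann γ β S := by
  rw [halfBoltzmann, factor, ← mul_assoc,
    ← Matrix.exp_add_of_commute _ _ (Commute.refl ((β / 2) • H.restrict γ (S.erase i))).neg_left,
    neg_add_cancel,
    NormedSpace.exp_zero, one_mul, halfBoltzmann]

theorem FermionicHamiltonian.factor_conjTranspose_mul (hγ : IsMajorana γ)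
    (H : FermionicHamiltonian n R d) (β : ℝ) (S : Finset (Fin (2 * n))) (i : Fin (2 * n)) :
    (H.factor γ β S i)ᴴ * H.halfBoltzmann γ β (S.erase i) = H.halfBoltzmann γ β S := by
  have h := congrArg conjTranspose (H.halfBoltzmann_erase_mul_factor (γ := γ) β S i)
  rwa [conjTranspose_mul, (H.isHermitian_halfBoltzmann hγ β _).eq,
    (H.isHermitian_halfBoltzmann hγ β _).eq] at h

theorem FermionicHamiltonian.halfBoltzmann_univ_mul_self (H : FermionicHamiltonian n R d)
    (β : ℝ) : H.halfBoltzmann γ β Finset.univ * H.halfBoltzmann γ β Finset.univ =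
      H.boltzmann γ β := by
  rw [halfBoltzmann, ← Matrix.exp_add_of_commute _ _ (Commute.refl _), boltzmann, ← neg_add,
    ← add_smul, add_halves]
  congr 3
  simp [restrict, op]

theorem FermionicHamiltonian.halfBoltzmann_empty (H : FermionicHamiltonian n R d)
    (β : ℝ) : H.halfBoltzmann γ β ∅ = 1 := by
  have h : H.restrict γ ∅ = 0 := by
    rw [restrict, Finset.sum_eq_zero]
    intro a ha
    have h1 := (Finset.mem_filter.1 ha).2
    exact absurd (Finset.subset_empty.1 h1) (H.supp_nonempty a).ne_empty
  rw [halfBoltzmann, h, smul_zero, neg_zero, NormedSpace.exp_zero]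

/-- The operator whose expectation the algorithm preserves: `E_S (I + α Γ) σ E_S` with
`E_S = e^{-β H^S / 2}`. -/
noncomputable def stateValue (H : FermionicHamiltonian n R d) (γ : Fin (2 * n) → Matrix ι ι ℂ)
    (β : ℝ) (s : AlgState n ι) : Matrix ι ι ℂ :=
  H.halfBoltzmann γ β s.S * ((1 + s.α • s.Γ) * s.σ) * H.halfBoltzmann γ β s.S

theorem stateValue_absorb (s : AlgState n ι) :
    stateValue H γ β (absorb s) = stateValue H γ β s := by
  rw [absorb]
  split_ifs with h
  · simp [stateValue]
  · rfl

theorem hasMean_pin (hγ : IsMajorana γ) (s : AlgState n ι) :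
    HasMean ((pin γ s).map absorb) (stateValue H γ β) (stateValue H γ β s) := by
  rw [pin]
  split_ifs with h
  · simp only
    set U := majoranaSupp γ s.Γ \ s.S
    have hkl : U.min' (Finset.card_pos.1 (Nat.zero_lt_of_lt h)) ≠
        U.max' (Finset.card_pos.1 (Nat.zero_lt_of_lt h)) :=
      (Finset.min'_lt_max'_of_card U h).ne
    have hP := hγ.pair_mul_self hkl
    set P := Complex.I • (γ (U.min' (Finset.card_pos.1 (Nat.zero_lt_of_lt h))) *
      γ (U.max' (Finset.card_pos.1 (Nat.zero_lt_of_lt h))))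
    rw [PMF.map_comp]
    refine HasMean.map_of_fintype ?_
    simp only [Function.comp_apply, stateValue_absorb]
    have hm := hasMean_fintype (PMF.uniformOfFintype Bool) fun b => stateValue H γ β
      (if b = true then { s with Γ := s.Γ * P, σ := (1 + P) * s.σ }
        else { s with Γ := -(s.Γ * P), σ := (1 - P) * s.σ })
    convert hm using 1
    have hv : stateValue H γ β { s with Γ := s.Γ * P, σ := (1 + P) * s.σ } +
        stateValue H γ β { s with Γ := -(s.Γ * P), σ := (1 - P) * s.σ } =
        (2 : ℝ) • stateValue H γ β s := by
      simp only [stateValue]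
      rw [← add_mul, ← mul_add, ← mul_assoc, ← mul_assoc, ← add_mul]
      -- The terms linear in P cancel between the two signs, and P² = 1 turns ΓP·P back into Γ.
      have h1 : (1 + s.α • (s.Γ * P)) * (1 + P) + (1 + s.α • -(s.Γ * P)) * (1 - P) =
          (2 : ℝ) • (1 + s.α • s.Γ) := by
        have h2 : s.Γ * P * P = s.Γ := by rw [mul_assoc, hP, mul_one]
        simp only [add_mul, mul_add, mul_sub, one_mul, mul_one, smul_neg, neg_mul,
          smul_mul_assoc, h2, two_smul]
        abel
      rw [h1, smul_mul_assoc, mul_smul_comm, smul_mul_assoc]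
    simp only [Fintype.sum_bool, PMF.uniformOfFintype_apply, Fintype.card_bool, if_true,
      Bool.false_eq_true, if_false]
    rw [← smul_add, hv, smul_smul]
    simp
  · rw [PMF.pure_map]
    rw [← stateValue_absorb]
    exact hasMean_pure _ _

/-- The Hermitian part of an operator. -/
noncomputable def hermPart {κ : Type*} (X : Matrix κ κ ℂ) : Matrix κ κ ℂ := (1 / 2 : ℝ) • (X + Xᴴ)

theorem hermPart_eq_self {κ : Type*} {X : Matrix κ κ ℂ} (h : X.IsHermitian) : hermPart X = X := by
  rw [hermPart, h.eq, ← two_smul ℝ, smul_smul]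
  norm_num

/-- The linear map `X ↦ E (Re X) σ E`. -/
noncomputable def sandwich (E σ : Matrix ι ι ℂ) : Matrix ι ι ℂ →L[ℝ] Matrix ι ι ℂ :=
  LinearMap.toContinuousLinearMap
    { toFun := fun X => E * (hermPart X * σ) * E
      map_add' := fun X Y => by
        simp only [hermPart, conjTranspose_add, ← add_mul, ← mul_add, ← smul_add]
        congr 4
        abel
      map_smul' := fun c X => by
        simp only [hermPart, conjTranspose_smul, star_trivial, ← smul_add, smul_mul_assoc,
          mul_smul_comm, RingHom.id_apply]
        rw [smul_comm] }

theorem sandwich_apply (E σ X : Matrix ι ι ℂ) : sandwich E σ X = E * (hermPart X * σ) * E := rfl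

/-- An anti-Hermitian Γ disappears from the Hermitian part of 1 + αΓ and a Hermitian one is kept, so
the discard is a real-linear map and commutes with expectations. -/
theorem stateValue_discard {s : AlgState n ι} (h : s.Γᴴ = s.Γ ∨ s.Γᴴ = -s.Γ) :
    stateValue H γ β (discard s) =
      sandwich (H.halfBoltzmann γ β s.S) s.σ (1 + s.α • s.Γ) := by
  rw [sandwich_apply, discard]
  have h1 : (1 + s.α • s.Γ)ᴴ = 1 + s.α • s.Γᴴ := by
    rw [conjTranspose_add, conjTranspose_one, conjTranspose_smul, star_trivial]
  split_ifs with hs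
  · rw [hermPart_eq_self (by rw [IsHermitian, h1, hs.eq])]
    rfl
  · have h2 := h.resolve_left hs
    have h3 : hermPart (1 + s.α • s.Γ) = 1 := by
      rw [hermPart, h1, h2, smul_neg]
      have : 1 + s.α • s.Γ + (1 + -(s.α • s.Γ)) = (2 : ℝ) • 1 := by
        rw [two_smul]; abel
      rw [this, smul_smul]
      norm_num
    rw [h3]
    simp [stateValue]

/-- The product expands into the identity and seven further terms, one for each update; the factor
on α in each update is the reciprocal of its probability. -/
theorem hasMean_update (hR : 2 ≤ R) (Γ Λ₁ Λ₂ : Matrix ι ι ℂ) (α b₁ b₂ : ℝ) :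
    HasMean (updatePMF R hR) (fun x => 1 + (update R Γ α Λ₁ Λ₂ b₁ b₂ x).2 •
        (update R Γ α Λ₁ Λ₂ b₁ b₂ x).1)
      ((1 + b₁ • Λ₁) * (1 + α • Γ) * (1 + b₂ • Λ₂)) := by
  have h := hasMean_fintype (updatePMF R hR) fun x => 1 + (update R Γ α Λ₁ Λ₂ b₁ b₂ x).2 •
        (update R Γ α Λ₁ Λ₂ b₁ b₂ x).1
  convert h using 1
  have hR0 : (R : ℝ) ≠ 0 := by
    have : R ≠ 0 := by omega
    exact_mod_cast this
  have hR1 : (1 - 1 / (R : ℝ)) ≠ 0 := by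
    have : (2 : ℝ) ≤ R := by exact_mod_cast hR
    have h1 : 1 / (R : ℝ) ≤ 1 / 2 := one_div_le_one_div_of_le (by norm_num) this
    linarith
  have hp : ∀ x, (updatePMF R hR x).toReal =
      if x = 0 then 1 - 1 / (R : ℝ) else (6 * (R : ℝ))⁻¹ := by
    intro x
    change (updateProb R x).toReal = _
    rw [updateProb]
    split_ifs
    · rw [ENNReal.toReal_sub_of_le _ ENNReal.one_ne_top]
      · simp
      · rw [ENNReal.inv_le_one]
        exact_mod_cast (by omega : 1 ≤ R)
    · simp
  have h6 : (6 * (R : ℝ))⁻¹ * (6 * R) = 1 := inv_mul_cancel₀ (by positivity)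
  simp only [smul_add, Finset.sum_add_distrib]
  have hsum : ∑ x, (updatePMF R hR x).toReal = 1 := by
    have := (PMF.hasSum_toReal (updatePMF R hR)).tsum_eq
    rwa [tsum_fintype] at this
  rw [← Finset.sum_smul, hsum, one_smul]
  simp only [Fin.sum_univ_seven, hp, smul_smul]
  simp only [update, Matrix.cons_val]
  have e0 : (1 - 1 / (R : ℝ)) * ((1 - 1 / (R : ℝ))⁻¹ * α) = α := by
    rw [← mul_assoc, mul_inv_cancel₀ hR1, one_mul]
  have e : ∀ y : ℝ, (6 * (R : ℝ))⁻¹ * (6 * R * y) = y := fun y => by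
    rw [← mul_assoc, h6, one_mul]
  simp only [if_true, Fin.reduceEq, if_false, e0, e]
  simp only [add_mul, mul_add, one_mul, mul_one, smul_mul_smul_comm]
  abel

/-- One iteration preserves the expectation of `stateValue`. -/
theorem hasMean_algStep [Nonempty ι] (hγ : IsMajorana γ) (hβ : 0 ≤ β)
    (hNR : 1 ≤ N * R) (hN : 0 ≤ N) (hβN : β * d * (N * R) ≤ 1 / 2) {s : AlgState n ι}
    (hS : s.S.Nonempty) (hΓ : s.Γ.IsHermitian)
    (hσ : ∀ i, Commute (H.factor γ β s.S i)ᴴ s.σ)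
    (hu : ∀ i, ∀ w₁ ∈ (wordPMF H γ β N s.S i).support, ∀ w₂ ∈ (wordPMF H γ β N s.S i).support,
      ∀ x, let Γ' := (update R s.Γ s.α (sampledString H γ w₁) (sampledString H γ w₂)ᴴ
        (sampledScale H N w₁) (sampledScale H N w₂) x).1
      Γ'ᴴ = Γ' ∨ Γ'ᴴ = -Γ')
    {C : ℝ} (hC : ∀ s' ∈ (algStep H γ β N s).support, ‖stateValue H γ β s'‖ ≤ C) :
    HasMean (algStep H γ β N s) (stateValue H γ β) (stateValue H γ β s) := by
  rw [algStep, dif_pos hS] at hC ⊢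
  set i := pickSite (majoranaSupp γ s.Γ) s.S hS
  simp only at hC ⊢
  set Φ := sandwich (H.halfBoltzmann γ β (s.S.erase i)) s.σ with hΦ
  set F := H.factor γ β s.S i with hF
  set Y := 1 + s.α • s.Γ with hY
  have hYH : Yᴴ = Y := by
    rw [hY, conjTranspose_add, conjTranspose_one, conjTranspose_smul, star_trivial, hΓ.eq]
  have hw : HasMean (wordPMF H γ β N s.S i)
      (fun w => 1 + sampledScale H N w • sampledString H γ w) F :=
    hasSum_wordPMF hγ hβ hNR hN hβN
  have hw' : HasMean (wordPMF H γ β N s.S i)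
      (fun w => 1 + sampledScale H N w • (sampledString H γ w)ᴴ) Fᴴ := by
    have h := HasSum.matrix_conjTranspose hw
    simpa [HasMean, conjTranspose_add, conjTranspose_smul] using h
  -- Although single samples may be non-Hermitian, F Y Fᴴ is Hermitian, so taking the Hermitian part
  -- does not change the mean. Commutation with σ moves Fᴴ to the right, where it is absorbed into
  -- E_S.
  have hfin : stateValue H γ β s = Φ (F * Y * Fᴴ) := by
    have hH : (F * Y * Fᴴ).IsHermitian := by
      rw [IsHermitian, conjTranspose_mul, conjTranspose_mul, conjTranspose_conjTranspose, hYH,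
        mul_assoc]
    rw [hΦ, sandwich_apply, hermPart_eq_self hH, mul_assoc (F * Y), (hσ i).eq, stateValue]
    nth_rw 1 [← H.halfBoltzmann_erase_mul_factor β s.S i]
    rw [← H.factor_conjTranspose_mul hγ β s.S i]
    simp only [mul_assoc, hY, hF]
  rw [hfin]
  refine HasMean.bind₃ hC (fun w₁ _ w₂ _ x => hasMean_pin hγ _) (g₂ := fun w₁ w₂ =>
      Φ ((1 + sampledScale H N w₁ • sampledString H γ w₁) * Y *
        (1 + sampledScale H N w₂ • (sampledString H γ w₂)ᴴ)))
    (g₁ := fun w₁ => Φ ((1 + sampledScale H N w₁ • sampledString H γ w₁) * Y * Fᴴ))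
    (fun w₁ h₁ w₂ h₂ => ?_) (fun w₁ _ => ?_) ?_
  · refine ((hasMean_update H.two_le_locality s.Γ (sampledString H γ w₁)
      (sampledString H γ w₂)ᴴ s.α (sampledScale H N w₁) (sampledScale H N w₂)).mapL Φ).congr
      fun x _ => ?_
    have hd := stateValue_discard (H := H) (γ := γ) (β := β) (s := ⟨s.S.erase i,
      (update R s.Γ s.α (sampledString H γ w₁) (sampledString H γ w₂)ᴴ (sampledScale H N w₁)
        (sampledScale H N w₂) x).1,
      (update R s.Γ s.α (sampledString H γ w₁) (sampledString H γ w₂)ᴴ (sampledScale H N w₁)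
        (sampledScale H N w₂) x).2, s.σ⟩) (hu i w₁ h₁ w₂ h₂ x)
    exact hd.symm
  · refine HasMean.mapL ?_ Φ
    have := HasSum.mul_left ((1 + sampledScale H N w₁ • sampledString H γ w₁) * Y) hw'
    simpa only [HasMean, mul_smul_comm] using this
  · refine HasMean.mapL ?_ Φ
    have := HasSum.mul_right (Y * Fᴴ) hw
    simpa only [HasMean, smul_mul_assoc, mul_assoc] using this

end Martingale

end HighTempFermion

namespace HighTempFermion

open Matrix
open scoped Matrix.Norms.L2Operator

/-! ### The invariant of the algorithm -/

section Decay

variable {R : ℕ}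

theorem one_sub_inv_pos (hR : 2 ≤ R) : 0 < 1 - 1 / (R : ℝ) := by
  have h : (2 : ℝ) ≤ R := by exact_mod_cast hR
  have h1 : 1 / (R : ℝ) ≤ 1 / 2 := one_div_le_one_div_of_le (by norm_num) h
  linarith

theorem one_sub_inv_le_one : 1 - 1 / (R : ℝ) ≤ 1 := by
  have : 0 ≤ 1 / (R : ℝ) := by positivity
  linarith

/-- Bernoulli's inequality with the real exponent R/2 ≥ 1 bounds the square root of the right side
below by 1/2. Equality holds at R = 2. -/
theorem one_fourth_le_one_sub_inv_pow (hR : 2 ≤ R) : 1 / 4 ≤ (1 - 1 / (R : ℝ)) ^ R := by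
  have h : (2 : ℝ) ≤ R := by exact_mod_cast hR
  have h0 := one_sub_inv_pos hR
  have h1 := one_add_mul_self_le_rpow_one_add (s := -(1 / (R : ℝ))) (by linarith)
    (p := (R : ℝ) / 2) (by linarith)
  have h2 : 1 + (R : ℝ) / 2 * -(1 / (R : ℝ)) = 1 / 2 := by field_simp; norm_num
  rw [h2, ← sub_eq_add_neg] at h1
  have h3 : ((1 - 1 / (R : ℝ)) ^ ((R : ℝ) / 2)) ^ 2 = (1 - 1 / (R : ℝ)) ^ R := by
    rw [← Real.rpow_natCast, ← Real.rpow_mul h0.le, ← Real.rpow_natCast]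
    congr 1
    push_cast
    ring
  rw [← h3]
  nlinarith

theorem scale_le_decay (hR : 2 ≤ R) {N : ℝ} (hN : 24 ≤ N) {t k : ℕ} (ht : t ≠ 0)
    (hk : k ≤ t * R) : 6 * R * ((N * R) ^ t)⁻¹ ≤ (1 - 1 / (R : ℝ)) ^ k := by
  have h : (2 : ℝ) ≤ R := by exact_mod_cast hR
  have h1 : (1 / 4 : ℝ) ^ t ≤ (1 - 1 / (R : ℝ)) ^ k := by
    calc (1 / 4 : ℝ) ^ t ≤ ((1 - 1 / (R : ℝ)) ^ R) ^ t := by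
          gcongr; exact one_fourth_le_one_sub_inv_pow hR
      _ = (1 - 1 / (R : ℝ)) ^ (t * R) := by rw [← pow_mul, mul_comm]
      _ ≤ _ := pow_le_pow_of_le_one (one_sub_inv_pos hR).le one_sub_inv_le_one hk
  refine le_trans ?_ h1
  have h2 : (0 : ℝ) < (N * R) ^ t := by positivity
  rw [← div_eq_mul_inv, div_le_iff₀ h2, ← mul_pow]
  -- This is where N ≥ 24 is needed; t ≥ 1 then lets a single factor 6R be bounded by (6R)^t.
  have h3 : (6 * R : ℝ) ≤ 1 / 4 * (N * R) := by nlinarith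
  calc (6 * R : ℝ) = (6 * R) ^ 1 := (pow_one _).symm
    _ ≤ (6 * R) ^ t := pow_le_pow_right₀ (by linarith) (Nat.one_le_iff_ne_zero.2 ht)
    _ ≤ _ := by gcongr

end Decay

/-! ### Strings whose scale decays with their support in the current set -/

section Piece

variable {n : ℕ} {ι : Type*} [Fintype ι] [DecidableEq ι] {γ : Fin (2 * n) → Matrix ι ι ℂ}
  {q : ℝ} {U V S T : Finset (Fin (2 * n))}

/-- Either `Γ = 0`, or `Γ` is an even Majorana string supported in `U` and the scale `α` is small
compared to the number of elements of its support in `S`. -/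
def IsPiece (γ : Fin (2 * n) → Matrix ι ι ℂ) (q : ℝ) (U S : Finset (Fin (2 * n)))
    (Γ : Matrix ι ι ℂ) (α : ℝ) : Prop :=
  Γ = 0 ∨ ∃ A, IsString γ A Γ ∧ Even A.card ∧ A ⊆ U ∧ 0 ≤ α ∧ α ≤ q ^ (A ∩ S).card

theorem IsPiece.mono {Γ : Matrix ι ι ℂ} {α : ℝ} (h : IsPiece γ q U S Γ α) (hq0 : 0 ≤ q)
    (hq1 : q ≤ 1) (hU : U ⊆ V) (hT : T ⊆ S) : IsPiece γ q V T Γ α := by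
  rcases h with h | ⟨A, h1, h2, h3, h4, h5⟩
  · exact .inl h
  · exact .inr ⟨A, h1, h2, h3.trans hU, h4, h5.trans (pow_le_pow_of_le_one hq0 hq1
      (Finset.card_le_card (Finset.inter_subset_inter_left hT)))⟩

theorem IsPiece.mul (hγ : IsMajorana γ) (hq0 : 0 ≤ q) (hq1 : q ≤ 1) {Γ Γ' : Matrix ι ι ℂ}
    {α α' : ℝ} (h : IsPiece γ q U S Γ α) (h' : IsPiece γ q U S Γ' α') :
    IsPiece γ q U S (Γ * Γ') (α * α') := by
  rcases h with rfl | ⟨A, h1, h2, h3, h4, h5⟩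
  · exact .inl (zero_mul _)
  rcases h' with rfl | ⟨B, h1', h2', h3', h4', h5'⟩
  · exact .inl (mul_zero _)
  refine .inr ⟨symmDiff A B, h1.mul hγ h1', even_card_symmDiff h2 h2',
    symmDiff_le_sup.trans (Finset.union_subset h3 h3'), mul_nonneg h4 h4', ?_⟩
  calc α * α' ≤ q ^ (A ∩ S).card * q ^ (B ∩ S).card := mul_le_mul h5 h5' h4' (by positivity)
    _ = q ^ ((A ∩ S).card + (B ∩ S).card) := (pow_add _ _ _).symm
    _ ≤ _ := by
      refine pow_le_pow_of_le_one hq0 hq1 ?_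
      refine (Finset.card_le_card ?_).trans (Finset.card_union_le _ _)
      rw [← Finset.union_inter_distrib_right]
      exact Finset.inter_subset_inter_right (symmDiff_le_sup (a := A) (b := B))

theorem IsPiece.star_eq (hγ : IsMajorana γ) {Γ : Matrix ι ι ℂ} {α : ℝ}
    (h : IsPiece γ q U S Γ α) : Γᴴ = Γ ∨ Γᴴ = -Γ := by
  rcases h with rfl | ⟨A, h, -⟩
  · simp
  · exact h.conjTranspose hγ

theorem IsPiece.conjTranspose (hγ : IsMajorana γ) {Γ : Matrix ι ι ℂ} {α : ℝ}
    (h : IsPiece γ q U S Γ α) : IsPiece γ q U S Γᴴ α := by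
  rcases h with rfl | ⟨A, h, h'⟩
  · exact .inl conjTranspose_zero
  · exact .inr ⟨A, h.star hγ, h'⟩

theorem pickSite_mem (T S : Finset (Fin (2 * n))) (hS : S.Nonempty) : pickSite T S hS ∈ S := by
  rw [pickSite]
  split_ifs with h
  · exact (Finset.mem_inter.1 (Finset.min'_mem _ h)).2
  · exact Finset.min'_mem _ _

theorem pickSite_mem_inter (T S : Finset (Fin (2 * n))) (hS : S.Nonempty)
    (h : (T ∩ S).Nonempty) : pickSite T S hS ∈ T := by
  rw [pickSite, dif_pos h]
  exact (Finset.mem_inter.1 (Finset.min'_mem _ h)).1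

end Piece

/-! ### Preservation of the invariant by each step -/

section Invariant

variable {n R d : ℕ} {ι : Type*} [Fintype ι] [DecidableEq ι] {γ : Fin (2 * n) → Matrix ι ι ℂ}
  {H : FermionicHamiltonian n R d} {β N : ℝ}

/-- Two versions are kept because every update that uses a sampled string carries exactly one factor
6R: one sampled string pays for it, and a second one enters at its bare scale. -/
theorem isPiece_sampledString (hγ : IsMajorana γ) (hβ : 0 ≤ β) (hN : 24 ≤ N)
    (hβN : β * d * (N * R) ≤ 1 / 2) {S : Finset (Fin (2 * n))} {i : Fin (2 * n)}
    {w : List (Fin H.m ⊕ Fin H.m)} (hw : w ∈ (wordPMF H γ β N S i).support)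
    (T : Finset (Fin (2 * n))) :
    IsPiece γ (1 - 1 / (R : ℝ)) S T (sampledString H γ w) (6 * R * sampledScale H N w) ∧
      IsPiece γ (1 - 1 / (R : ℝ)) S T (sampledString H γ w) (sampledScale H N w) := by
  have hR := H.two_le_locality
  have hR' : (2 : ℝ) ≤ R := by exact_mod_cast hR
  rw [sampledString]
  split_ifs with h
  · exact ⟨.inl rfl, .inl rfl⟩
  have hc : wordCoeff H γ β S i w ≠ 0 := by
    intro h0
    refine (PMF.mem_support_iff _ _).1 hw ?_
    rw [wordPMF_apply hγ hβ (by linarith) hβN, wordProb, if_neg h, h0]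
    simp
  obtain ⟨A, hA, hAe, hAc, hAU⟩ := wordOp_isString (H := H) hγ w
  have hAS := hAU S fun x hx => supp_subset_of_wordCoeff_ne_zero hc hx
  have h0 : 0 ≤ sampledScale H N w := by rw [sampledScale]; positivity
  have h1 : 6 * R * sampledScale H N w ≤ (1 - 1 / (R : ℝ)) ^ (A ∩ T).card :=
    scale_le_decay hR hN (by simpa using h)
      ((Finset.card_le_card Finset.inter_subset_left).trans hAc)
  refine ⟨.inr ⟨A, hA, hAe, hAS, by positivity, h1⟩, .inr ⟨A, hA, hAe, hAS, h0, ?_⟩⟩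
  nlinarith

theorem isPiece_update (hγ : IsMajorana γ) (hβ : 0 ≤ β) (hN : 24 ≤ N)
    (hβN : β * d * (N * R) ≤ 1 / 2) {S T U : Finset (Fin (2 * n))} {i : Fin (2 * n)}
    {Γ : Matrix ι ι ℂ} {α : ℝ} (hSU : S ⊆ U)
    (h0 : IsPiece γ (1 - 1 / (R : ℝ)) U T Γ ((1 - 1 / (R : ℝ))⁻¹ * α))
    (h : IsPiece γ (1 - 1 / (R : ℝ)) U T Γ α) {w₁ w₂ : List (Fin H.m ⊕ Fin H.m)}
    (h₁ : w₁ ∈ (wordPMF H γ β N S i).support) (h₂ : w₂ ∈ (wordPMF H γ β N S i).support)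
    (x : Fin 7) :
    IsPiece γ (1 - 1 / (R : ℝ)) U T
      (update R Γ α (sampledString H γ w₁) (sampledString H γ w₂)ᴴ
        (sampledScale H N w₁) (sampledScale H N w₂) x).1
      (update R Γ α (sampledString H γ w₁) (sampledString H γ w₂)ᴴ
        (sampledScale H N w₁) (sampledScale H N w₂) x).2 := by
  have hq0 := (one_sub_inv_pos H.two_le_locality).le
  have hq1 := one_sub_inv_le_one (R := R)
  obtain ⟨a1, b1⟩ := isPiece_sampledString hγ hβ hN hβN h₁ T
  obtain ⟨a2, b2⟩ := isPiece_sampledString hγ hβ hN hβN h₂ T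
  replace a1 := a1.mono hq0 hq1 hSU subset_rfl
  replace b1 := b1.mono hq0 hq1 hSU subset_rfl
  replace a2 := (a2.mono hq0 hq1 hSU subset_rfl).conjTranspose hγ
  replace b2 := (b2.mono hq0 hq1 hSU subset_rfl).conjTranspose hγ
  fin_cases x
  · exact h0
  · exact a1
  · exact a2
  · have := a1.mul hγ hq0 hq1 h
    simpa [update, mul_assoc] using this
  · have := h.mul hγ hq0 hq1 a2
    simpa [update, mul_assoc, mul_comm, mul_left_comm] using this
  · have := a1.mul hγ hq0 hq1 b2
    simpa [update, mul_assoc] using this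
  · have := (a1.mul hγ hq0 hq1 h).mul hγ hq0 hq1 b2
    simpa [update, mul_assoc] using this

/-- The state consists of a multiple of a signed matching and a Hermitian string, which act on
disjoint sets of modes, such that the string acts on at most `m` modes outside `S`. -/
def StateInv (γ : Fin (2 * n) → Matrix ι ι ℂ) (q : ℝ) (m a b : ℕ) (s : AlgState n ι) : Prop :=
  ∃ (U : Finset (Fin (2 * n))) (c : ℝ) (M : List (Fin (2 * n) × Fin (2 * n) × ℤˣ)),
    s.S ⊆ U ∧ (U \ s.S).card ≤ m ∧ 0 ≤ c ∧ c ≤ 2 ^ a ∧ IsPartialMatching M ∧ M.length ≤ b ∧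
      (∀ p ∈ M, p.1 ∉ U ∧ p.2.1 ∉ U) ∧ s.σ = c • matchingProd γ M ∧ s.Γ.IsHermitian ∧
        IsPiece γ q U s.S s.Γ s.α

/-- The decay bound gives 0 ≤ α ≤ 1, so the absorbed scalar 1 ± α lies in [0, 2]: the sign of the
prefactor survives and its bound at most doubles. -/
theorem stateInv_absorb [Nonempty ι] {q : ℝ} (hq0 : 0 ≤ q) (hq1 : q ≤ 1)
    {m a b : ℕ} {s : AlgState n ι} (h : StateInv γ q m a b s) :
    StateInv γ q m (a + 1) b (absorb s) ∧ (absorb s).Γ ≠ 1 ∧ (absorb s).Γ ≠ -1 := by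
  obtain ⟨U, c, M, h1, h2, h3, h4, h5, h6, h7, h8, h9, h10⟩ := h
  rw [absorb]
  have h4' : c ≤ 2 ^ (a + 1) := h4.trans (pow_le_pow_right₀ (by norm_num) (Nat.le_succ a))
  split_ifs with hs
  · refine ⟨?_, zero_ne_one, fun h => one_ne_zero (neg_eq_zero.1 h.symm)⟩
    have hα : 0 ≤ s.α ∧ s.α ≤ 1 := by
      rcases h10 with h | ⟨A, -, -, -, h, h'⟩
      · rw [h] at hs
        rcases hs with hs | hs
        · exact absurd hs zero_ne_one
        · exact absurd (neg_eq_zero.1 hs.symm) one_ne_zero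
      · exact ⟨h, h'.trans (pow_le_one₀ hq0 hq1)⟩
    have key : ∃ e : ℝ, 0 ≤ e ∧ e ≤ 2 ∧ 1 + s.α • s.Γ = e • (1 : Matrix ι ι ℂ) := by
      rcases hs with hs | hs
      · exact ⟨1 + s.α, by linarith, by linarith, by rw [hs, add_smul, one_smul]⟩
      · exact ⟨1 - s.α, by linarith, by linarith, by
          rw [hs, sub_smul, one_smul, smul_neg, sub_eq_add_neg]⟩
    obtain ⟨e, he0, he2, he⟩ := key
    refine ⟨U, e * c, M, h1, h2, mul_nonneg he0 h3, ?_, h5, h6, h7, ?_, isHermitian_zero, .inl rfl⟩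
    · rw [pow_succ, mul_comm (2 ^ a)]
      exact mul_le_mul he2 h4 h3 (by norm_num)
    · simp only
      rw [he, h8, smul_mul_assoc, one_mul, smul_smul]
  · push Not at hs
    exact ⟨⟨U, c, M, h1, h2, h3, h4', h5, h6, h7, h8, h9, h10⟩, hs⟩

/-- If Γ has two modes outside S, they exhaust U \ S; they move into the matching and U shrinks to
S. Otherwise U is replaced by S together with the support of Γ. In both cases at most one mode of
the new U remains outside S. -/
theorem stateInv_pin [Nonempty ι] (hγ : IsMajorana γ) {q : ℝ} {a b : ℕ} {s s' : AlgState n ι}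
    (h : StateInv γ q 2 a b s) (hs' : s' ∈ (pin γ s).support) :
    s'.S = s.S ∧ StateInv γ q 1 a (b + 1) s' := by
  obtain ⟨U, c, M, h1, h2, h3, h4, h5, h6, h7, h8, h9, h10⟩ := h
  rw [pin] at hs'
  split_ifs at hs' with hc
  · rcases h10 with h0 | ⟨A, hA, hAe, hAU, hα0, hα⟩
    · rw [h0, hγ.majoranaSupp_zero] at hc
      simp at hc
    set V := majoranaSupp γ s.Γ \ s.S with hV
    have hVA : V = A \ s.S := by rw [hV, hA.majoranaSupp_eq hγ]
    have hVU : V = U \ s.S := by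
      refine Finset.eq_of_subset_of_card_le ?_ (h2.trans hc)
      rw [hVA]; exact Finset.sdiff_subset_sdiff hAU subset_rfl
    simp only at hs'
    set k := V.min' (Finset.card_pos.1 (Nat.zero_lt_of_lt hc))
    set l := V.max' (Finset.card_pos.1 (Nat.zero_lt_of_lt hc))
    have hkl : k ≠ l := (Finset.min'_lt_max'_of_card V hc).ne
    have hk : k ∈ V := Finset.min'_mem _ _
    have hl : l ∈ V := Finset.max'_mem _ _
    have hVkl : V = {k, l} := by
      symm
      refine Finset.eq_of_subset_of_card_le ?_ ?_
      · intro x hx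
        rcases Finset.mem_insert.1 hx with rfl | hx
        · exact hk
        · rwa [Finset.mem_singleton.1 hx]
      · rw [Finset.card_pair hkl, hVU]; exact h2
    have hkA : k ∈ A := by rw [hVA] at hk; exact (Finset.mem_sdiff.1 hk).1
    have hlA : l ∈ A := by rw [hVA] at hl; exact (Finset.mem_sdiff.1 hl).1
    have hkS : k ∉ s.S := (Finset.mem_sdiff.1 hk).2
    have hlS : l ∉ s.S := (Finset.mem_sdiff.1 hl).2
    set P := Complex.I • (γ k * γ l) with hP
    have hAP : symmDiff A {k, l} = A ∩ s.S := by
      rw [← hVkl, hVA]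
      ext x
      simp only [Finset.mem_symmDiff, Finset.mem_sdiff, Finset.mem_inter]
      tauto
    have hPs := hγ.isString_pair hkl
    have hPH := hγ.isHermitian_pair hkl
    have hΓP : IsString γ (A ∩ s.S) (s.Γ * P) := hAP ▸ hA.mul hγ hPs
    -- The support of Γ is even and contains both k and l, so Γ anticommutes with each of γ k and γ
    -- l, and the two signs cancel.
    have hcomm : Commute s.Γ P := by
      refine Commute.smul_right ?_ _
      rw [commute_iff_eq, mul_assoc (γ k), hA.anticommute_majorana hγ hAe hlA, mul_neg,
        ← mul_assoc (γ k), hA.anticommute_majorana hγ hAe hkA, neg_mul, neg_neg, mul_assoc]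
    have hΓPH : (s.Γ * P).IsHermitian := by
      rw [IsHermitian, conjTranspose_mul, hPH.eq, h9.eq, hcomm.eq]
    have hAPe : Even (A ∩ s.S).card := by
      rw [← hAP]
      exact even_card_symmDiff hAe (by rw [Finset.card_pair hkl]; exact even_two)
    have hM : ∀ e : ℤˣ, IsPartialMatching ((k, l, e) :: M) := by
      intro e
      have hU : ∀ x ∈ M.flatMap (fun p => [p.1, p.2.1]), x ∉ U := by
        intro x hx
        obtain ⟨p, hp, hx⟩ := List.mem_flatMap.1 hx
        simp only [List.mem_cons, List.not_mem_nil, or_false] at hx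
        rcases hx with rfl | rfl
        exacts [(h7 p hp).1, (h7 p hp).2]
      have hM1 : k ∉ M.flatMap (fun p => [p.1, p.2.1]) := fun h => hU k h (hAU hkA)
      have hM2 : l ∉ M.flatMap (fun p => [p.1, p.2.1]) := fun h => hU l h (hAU hlA)
      unfold IsPartialMatching at h5 ⊢
      rw [List.flatMap_cons]
      simp only [List.cons_append, List.nil_append, List.nodup_cons, List.mem_cons, not_or]
      exact ⟨⟨hkl, hM1⟩, hM2, h5⟩
    have hMS : ∀ e : ℤˣ, ∀ p ∈ (k, l, e) :: M, p.1 ∉ s.S ∧ p.2.1 ∉ s.S := by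
      intro e p hp
      rcases List.mem_cons.1 hp with rfl | hp
      · exact ⟨hkS, hlS⟩
      · exact ⟨fun h => (h7 p hp).1 (h1 h), fun h => (h7 p hp).2 (h1 h)⟩
    have hinter : A ∩ s.S ∩ s.S = A ∩ s.S := by rw [Finset.inter_assoc, Finset.inter_self]
    obtain ⟨e, -, rfl⟩ := (PMF.mem_support_map_iff _ _ _).1 hs'
    cases e
    · refine ⟨rfl, s.S, c, (k, l, -1) :: M, subset_rfl, by simp, h3, h4, hM _, by simpa using h6,
        hMS _, ?_, hΓPH.neg, .inr ⟨A ∩ s.S, hΓP.neg, hAPe, Finset.inter_subset_right, hα0, ?_⟩⟩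
      · change (1 - P) * s.σ = _
        rw [h8, mul_smul_comm, matchingProd, matchingProd, List.map_cons, List.prod_cons, hP]
        simp [sub_eq_add_neg]
      · change s.α ≤ q ^ (A ∩ s.S ∩ s.S).card
        rwa [hinter]
    · refine ⟨rfl, s.S, c, (k, l, 1) :: M, subset_rfl, by simp, h3, h4, hM _, by simpa using h6,
        hMS _, ?_, hΓPH, .inr ⟨A ∩ s.S, hΓP, hAPe, Finset.inter_subset_right, hα0, ?_⟩⟩
      · change (1 + P) * s.σ = _
        rw [h8, mul_smul_comm, matchingProd, matchingProd, List.map_cons, List.prod_cons, hP]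
        simp
      · change s.α ≤ q ^ (A ∩ s.S ∩ s.S).card
        rwa [hinter]
  · rw [PMF.support_pure, Set.mem_singleton_iff] at hs'
    subst hs'
    refine ⟨rfl, ?_⟩
    rcases h10 with h0 | ⟨A, hA, hAe, hAU, hα0, hα⟩
    · exact ⟨s'.S, c, M, subset_rfl, by simp, h3, h4, h5, by omega,
        fun p hp => ⟨fun h => (h7 p hp).1 (h1 h), fun h => (h7 p hp).2 (h1 h)⟩, h8, h9, .inl h0⟩
    · rw [hA.majoranaSupp_eq hγ] at hc
      refine ⟨s'.S ∪ A, c, M, Finset.subset_union_left, ?_, h3, h4, h5, by omega,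
        fun p hp => ⟨fun h => (h7 p hp).1 (Finset.union_subset h1 hAU h),
          fun h => (h7 p hp).2 (Finset.union_subset h1 hAU h)⟩, h8, h9,
        .inr ⟨A, hA, hAe, Finset.subset_union_right, hα0, hα⟩⟩
      rw [Finset.union_sdiff_left]
      omega

/-- The invariant of the algorithm after `j` iterations. -/
def AlgInv (γ : Fin (2 * n) → Matrix ι ι ℂ) (R j : ℕ) (s : AlgState n ι) : Prop :=
  s.S.card + j = 2 * n ∧ StateInv γ (1 - 1 / (R : ℝ)) 1 j j s ∧ s.Γ ≠ 1 ∧ s.Γ ≠ -1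

theorem algInv_init [Nonempty ι] : AlgInv γ R 0 (AlgState.init n ι) := by
  refine ⟨by simp [AlgState.init], ⟨Finset.univ, 1, [], Finset.Subset.refl _, by simp [AlgState.init],
    by norm_num, by norm_num, by simp [IsPartialMatching], by simp, by simp,
    by simp [AlgState.init, matchingProd], isHermitian_zero, .inl rfl⟩, ?_, ?_⟩
  · exact zero_ne_one
  · exact fun h => one_ne_zero (neg_eq_zero.1 h.symm)

/-- The updated string and scale, before the steps that discard, pin and absorb. -/
theorem AlgInv.isPiece_update [Nonempty ι] (hγ : IsMajorana γ) (hβ : 0 ≤ β) (hN : 24 ≤ N)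
    (hβN : β * d * (N * R) ≤ 1 / 2) {U : Finset (Fin (2 * n))} {s : AlgState n ι}
    (hΓ1 : s.Γ ≠ 1 ∧ s.Γ ≠ -1) (hSU : s.S ⊆ U) (hU : (U \ s.S).card ≤ 1) (hΓ : s.Γ.IsHermitian)
    (hs : IsPiece γ (1 - 1 / (R : ℝ)) U s.S s.Γ s.α) (hS : s.S.Nonempty)
    {w₁ w₂ : List (Fin H.m ⊕ Fin H.m)} {i : Fin (2 * n)}
    (h₁ : w₁ ∈ (wordPMF H γ β N s.S i).support)
    (h₂ : w₂ ∈ (wordPMF H γ β N s.S i).support) (x : Fin 7) :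
    IsPiece γ (1 - 1 / (R : ℝ)) U (s.S.erase (pickSite (majoranaSupp γ s.Γ) s.S hS))
      (update R s.Γ s.α (sampledString H γ w₁) (sampledString H γ w₂)ᴴ
        (sampledScale H N w₁) (sampledScale H N w₂) x).1
      (update R s.Γ s.α (sampledString H γ w₁) (sampledString H γ w₂)ᴴ
        (sampledScale H N w₁) (sampledScale H N w₂) x).2 := by
  have hq := one_sub_inv_pos H.two_le_locality
  have hq1 := one_sub_inv_le_one (R := R)
  refine HighTempFermion.isPiece_update hγ hβ hN hβN hSU ?_
    (hs.mono hq.le hq1 subset_rfl (Finset.erase_subset _ _)) h₁ h₂ x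
  rcases hs with h0 | ⟨A, hA, hAe, hAU, hα0, hα⟩
  · exact .inl h0
  refine .inr ⟨A, hA, hAe, hAU, by positivity, ?_⟩
  -- An even support with at most one mode outside S either meets S or is empty, and an empty one
  -- would make Γ = ±1, which has been absorbed. So the chosen site lies in the support, and its
  -- removal lowers the exponent by one, which pays for the factor (1 - 1/R)⁻¹.
  have hAS : (A ∩ s.S).Nonempty := by
    by_contra hne
    rw [Finset.not_nonempty_iff_eq_empty] at hne
    have hsub : A ⊆ U \ s.S := fun x hx => Finset.mem_sdiff.2
      ⟨hAU hx, fun hxS => Finset.notMem_empty x (hne ▸ Finset.mem_inter.2 ⟨hx, hxS⟩)⟩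
    have hcard := (Finset.card_le_card hsub).trans hU
    have hA0 : A = ∅ := by
      rw [← Finset.card_eq_zero]
      rcases hAe with ⟨r, hr⟩
      omega
    rw [hA0] at hA
    rcases hA.eq_one_or_of_isHermitian hΓ with h | h
    exacts [hΓ1.1 h, hΓ1.2 h]
  rw [hA.majoranaSupp_eq hγ]
  have hi := pickSite_mem_inter A s.S hS hAS
  have hi' := pickSite_mem A s.S hS
  rw [Finset.inter_erase]
  have hcard := Finset.card_erase_add_one (Finset.mem_inter.2 ⟨hi, hi'⟩)
  rw [inv_mul_le_iff₀ hq, ← pow_succ', hcard]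
  exact hα

theorem algInv_step [Nonempty ι] (hγ : IsMajorana γ) (hβ : 0 ≤ β) (hN : 24 ≤ N)
    (hβN : β * d * (N * R) ≤ 1 / 2) {j : ℕ} {s s' : AlgState n ι} (h : AlgInv γ R j s)
    (hS : s.S.Nonempty) (hs' : s' ∈ (algStep H γ β N s).support) : AlgInv γ R (j + 1) s' := by
  have hq := one_sub_inv_pos H.two_le_locality
  have hq1 := one_sub_inv_le_one (R := R)
  obtain ⟨hcard, ⟨U, c, M, h1, h2, h3, h4, h5, h6, h7, h8, h9, h10⟩, hΓ1⟩ := h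
  rw [algStep, dif_pos hS] at hs'
  simp only [PMF.mem_support_bind_iff] at hs'
  obtain ⟨w₁, hw₁, w₂, hw₂, x, -, hs'⟩ := hs'
  have hp := AlgInv.isPiece_update hγ hβ hN hβN hΓ1 h1 h2 h9 h10 hS hw₁ hw₂ x
  have hiS := pickSite_mem (majoranaSupp γ s.Γ) s.S hS
  set i := pickSite (majoranaSupp γ s.Γ) s.S hS
  set u := update R s.Γ s.α (sampledString H γ w₁) (sampledString H γ w₂)ᴴ
    (sampledScale H N w₁) (sampledScale H N w₂) x
  obtain ⟨s₁, hs₁, rfl⟩ := (PMF.mem_support_map_iff _ _ _).1 hs'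
  have hSS : (discard ⟨s.S.erase i, u.1, u.2, s.σ⟩).S = s.S.erase i := by
    rw [discard]; split_ifs <;> rfl
  -- Removing i from S adds it to the modes outside S; pinning brings the bound back to 1.
  have hU2 : (U \ s.S.erase i).card ≤ 2 := by
    have hsub : U \ s.S.erase i ⊆ insert i (U \ s.S) := by
      intro x hx
      simp only [Finset.mem_sdiff, Finset.mem_erase, Finset.mem_insert] at hx ⊢
      tauto
    exact (Finset.card_le_card hsub).trans ((Finset.card_insert_le _ _).trans (by omega))
  have hdis : StateInv γ (1 - 1 / (R : ℝ)) 2 j j (discard ⟨s.S.erase i, u.1, u.2, s.σ⟩) := by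
    rw [discard]
    split_ifs with hh
    · exact ⟨U, c, M, (Finset.erase_subset _ _).trans h1, hU2, h3, h4, h5, h6, h7, h8, hh, hp⟩
    · exact ⟨U, c, M, (Finset.erase_subset _ _).trans h1, hU2, h3, h4, h5, h6, h7, h8,
        isHermitian_zero, .inl rfl⟩
  obtain ⟨hS₁, hpin⟩ := stateInv_pin hγ hdis hs₁
  have hS2 : (absorb s₁).S = s₁.S := by rw [absorb]; split_ifs <;> rfl
  refine ⟨?_, stateInv_absorb hq.le hq1 hpin⟩
  have hce := Finset.card_erase_add_one hiS
  rw [hS2, hS₁, hSS]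
  omega

end Invariant

end HighTempFermion

namespace HighTempFermion

open Matrix
open scoped Matrix.Norms.L2Operator

/-! ### The output of the algorithm and the Gibbs state -/

section Output

variable {n R d : ℕ} {ι : Type*} [Fintype ι] [DecidableEq ι] {γ : Fin (2 * n) → Matrix ι ι ℂ}
  {H : FermionicHamiltonian n R d} {β N : ℝ}

theorem commute_matchingProd {X : Matrix ι ι ℂ} {M : List (Fin (2 * n) × Fin (2 * n) × ℤˣ)}
    (h : ∀ p ∈ M, Commute X (γ p.1) ∧ Commute X (γ p.2.1)) : Commute X (matchingProd γ M) := by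
  refine Commute.list_prod_right _ _ fun m hm => ?_
  obtain ⟨p, hp, rfl⟩ := List.mem_map.1 hm
  exact (Commute.one_right _).add_right (((h p hp).1.mul_right (h p hp).2).smul_right _)

theorem FermionicHamiltonian.commute_restrict (hγ : IsMajorana γ) (H : FermionicHamiltonian n R d)
    {S : Finset (Fin (2 * n))} {k : Fin (2 * n)} (hk : k ∉ S) :
    Commute (H.restrict γ S) (γ k) := by
  refine Commute.sum_left _ _ _ fun a ha => Commute.smul_left ?_ _
  exact ((H.isString a).commute_majorana hγ (H.supp_even a)
    fun h => hk ((Finset.mem_filter.1 ha).2 h)).symm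

theorem FermionicHamiltonian.commute_factor_conjTranspose (hγ : IsMajorana γ)
    (H : FermionicHamiltonian n R d) {S : Finset (Fin (2 * n))} (i : Fin (2 * n))
    {M : List (Fin (2 * n) × Fin (2 * n) × ℤˣ)} (hM : ∀ p ∈ M, p.1 ∉ S ∧ p.2.1 ∉ S) :
    Commute (H.factor γ β S i)ᴴ (matchingProd γ M) := by
  have key : ∀ T ⊆ S, ∀ c : ℝ,
      Commute (NormedSpace.exp (c • H.restrict γ T))ᴴ (matchingProd γ M) := by
    intro T hT c
    rw [← Matrix.exp_conjTranspose, conjTranspose_smul, (H.isHermitian_restrict hγ T).eq,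
      star_trivial]
    refine Commute.exp_left (Commute.smul_left (commute_matchingProd fun p hp => ?_) c)
    exact ⟨H.commute_restrict hγ fun h => (hM p hp).1 (hT h),
      H.commute_restrict hγ fun h => (hM p hp).2 (hT h)⟩
  rw [factor, conjTranspose_mul, ← neg_smul]
  exact (key _ subset_rfl _).mul_left (key _ (Finset.erase_subset _ _) _)

theorem IsMajorana.norm_le_one [Nonempty ι] (hγ : IsMajorana γ) (j : Fin (2 * n)) :
    ‖γ j‖ ≤ 1 := by
  have h := hγ.isString_prod (l := [j]) (by simp)
  simpa using h.norm_le_one hγ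

theorem norm_matchingProd_le [Nonempty ι] (hγ : IsMajorana γ)
    (M : List (Fin (2 * n) × Fin (2 * n) × ℤˣ)) : ‖matchingProd γ M‖ ≤ 2 ^ M.length := by
  induction M with
  | nil => simp [matchingProd]
  | cons p M ih =>
    rw [matchingProd, List.map_cons, List.prod_cons, List.length_cons, pow_succ']
    refine (norm_mul_le _ _).trans (mul_le_mul ?_ ih (norm_nonneg _) (by norm_num))
    refine (norm_add_le _ _).trans ?_
    rw [CStarRing.norm_one, norm_smul, norm_mul, Complex.norm_I]
    have h1 : ‖((p.2.2 : ℤ) : ℂ)‖ = 1 := by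
      rcases Int.units_eq_one_or p.2.2 with h | h <;> rw [h] <;> simp
    have h2 := (norm_mul_le (γ p.1) (γ p.2.1)).trans
      (mul_le_one₀ (hγ.norm_le_one _) (norm_nonneg _) (hγ.norm_le_one _))
    rw [h1]
    linarith

/-- A crude bound uniform over the states satisfying the invariant. There are infinitely many words,
and `HasMean.bind` requires such a bound to interchange the sums. -/
theorem exists_norm_stateValue_le [Nonempty ι] (hγ : IsMajorana γ) (H : FermionicHamiltonian n R d)
    (β : ℝ) (j : ℕ) :
    ∃ C : ℝ, ∀ s : AlgState n ι, AlgInv γ R j s → ‖stateValue H γ β s‖ ≤ C := by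
  set K := ∑ S, ‖H.halfBoltzmann γ β S‖ with hK
  have hK0 : ∀ S, ‖H.halfBoltzmann γ β S‖ ≤ K := fun S =>
    Finset.single_le_sum (f := fun S => ‖H.halfBoltzmann γ β S‖)
      (fun _ _ => norm_nonneg _) (Finset.mem_univ S)
  have hKn : 0 ≤ K := (norm_nonneg _).trans (hK0 ∅)
  refine ⟨K * (2 * (2 ^ j * 2 ^ j)) * K, fun s hs => ?_⟩
  obtain ⟨-, ⟨U, c, M, -, -, h3, h4, -, h6, -, h8, -, h10⟩, -⟩ := hs
  have hσ : ‖s.σ‖ ≤ 2 ^ j * 2 ^ j := by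
    rw [h8, norm_smul, Real.norm_of_nonneg h3]
    exact mul_le_mul h4 ((norm_matchingProd_le hγ M).trans
      (pow_le_pow_right₀ (by norm_num) h6)) (norm_nonneg _) (by positivity)
  have hΓ : ‖1 + s.α • s.Γ‖ ≤ 2 := by
    rcases h10 with h | ⟨A, hA, -, -, hα0, hα⟩
    · rw [h, smul_zero, add_zero, CStarRing.norm_one]; norm_num
    · refine (norm_add_le _ _).trans ?_
      rw [CStarRing.norm_one, norm_smul, Real.norm_of_nonneg hα0]
      have h1 := hA.norm_le_one hγ
      have h2 : s.α ≤ 1 := hα.trans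
        (pow_le_one₀ (one_sub_inv_pos H.two_le_locality).le one_sub_inv_le_one)
      nlinarith [norm_nonneg s.Γ]
  rw [stateValue]
  refine (norm_mul_le _ _).trans (mul_le_mul ((norm_mul_le _ _).trans (mul_le_mul (hK0 _) ?_
    (norm_nonneg _) hKn)) (hK0 _) (norm_nonneg _) (by positivity))
  exact (norm_mul_le _ _).trans (mul_le_mul hΓ hσ (norm_nonneg _) (by norm_num))

theorem algRun_spec [Nonempty ι] (hγ : IsMajorana γ) (hβ : 0 ≤ β) (hN : 24 ≤ N)
    (hβN : β * d * (N * R) ≤ 1 / 2) (j : ℕ) (hj : j ≤ 2 * n) :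
    (∀ s ∈ (algRun H γ β N j).support, AlgInv γ R j s) ∧
      HasMean (algRun H γ β N j) (stateValue H γ β) (H.boltzmann γ β) := by
  have hR' : (2 : ℝ) ≤ R := by exact_mod_cast H.two_le_locality
  induction j with
  | zero =>
    constructor
    · intro s hs
      rw [algRun, PMF.support_pure, Set.mem_singleton_iff] at hs
      rw [hs]
      exact algInv_init
    · have h := hasMean_pure (AlgState.init n ι) (stateValue H γ β)
      rw [algRun]
      convert h using 1
      simp [stateValue, AlgState.init, H.halfBoltzmann_univ_mul_self]
  | succ j ih =>
    obtain ⟨ih1, ih2⟩ := ih (by omega)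
    have hne : ∀ s ∈ (algRun H γ β N j).support, s.S.Nonempty := by
      intro s hs
      have := (ih1 s hs).1
      rw [← Finset.card_pos]
      omega
    have hstep : ∀ s ∈ (algRun H γ β N j).support, ∀ s' ∈ (algStep H γ β N s).support,
        AlgInv γ R (j + 1) s' := fun s hs s' hs' =>
      algInv_step hγ hβ hN hβN (ih1 s hs) (hne s hs) hs'
    obtain ⟨C, hC⟩ := exists_norm_stateValue_le hγ H β (j + 1)
    constructor
    · intro s' hs'
      obtain ⟨s, hs, hs'⟩ := (PMF.mem_support_bind_iff _ _ _).1 hs'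
      exact hstep s hs s' hs'
    · refine HasMean.bind (C := C) (fun s hs s' hs' => hC s' (hstep s hs s' hs'))
        (fun s hs => ?_) ih2
      obtain ⟨hcard, ⟨U, c, M, h1, h2, h3, h4, h5, h6, h7, h8, h9, h10⟩, hΓ1⟩ := ih1 s hs
      refine hasMean_algStep hγ hβ (by nlinarith) (by linarith) hβN (hne s hs) h9 (fun i => ?_)
        (fun i w₁ hw₁ w₂ hw₂ x => ?_) (fun s' hs' => hC s' (hstep s hs s' hs'))
      · rw [h8]
        exact (H.commute_factor_conjTranspose hγ i fun p hp =>
          ⟨fun h => (h7 p hp).1 (h1 h), fun h => (h7 p hp).2 (h1 h)⟩).smul_right c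
      · exact (AlgInv.isPiece_update hγ hβ hN hβN hΓ1 h1 h2 h9 h10 (hne s hs) hw₁ hw₂ x).star_eq hγ

/-- With S empty, a nonzero Γ would have an even support of at most one mode, hence be ±1, which the
absorbing step excludes. -/
theorem AlgInv.Γ_eq_zero [Nonempty ι] {s : AlgState n ι} (h : AlgInv γ R (2 * n) s) :
    s.S = ∅ ∧ s.Γ = 0 := by
  obtain ⟨hcard, ⟨U, c, M, h1, h2, h3, h4, h5, h6, h7, h8, h9, h10⟩, hΓ1⟩ := h
  have hS : s.S = ∅ := Finset.card_eq_zero.1 (by omega)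
  refine ⟨hS, ?_⟩
  rcases h10 with h | ⟨A, hA, hAe, hAU, -, -⟩
  · exact h
  · exfalso
    rw [hS, Finset.sdiff_empty] at h2
    have hcard := (Finset.card_le_card hAU).trans h2
    have hA0 : A = ∅ := by
      rw [← Finset.card_eq_zero]
      rcases hAe with ⟨r, hr⟩
      omega
    rw [hA0] at hA
    rcases hA.eq_one_or_of_isHermitian h9 with h | h
    exacts [hΓ1.1 h, hΓ1.2 h]

theorem trace_one_ne_zero [Nonempty ι] : trace (1 : Matrix ι ι ℂ) ≠ 0 := by
  rw [trace_one]
  exact_mod_cast Fintype.card_ne_zero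

theorem StateInv.isUnnormalizedGaussian [Nonempty ι] {q : ℝ} {m a b : ℕ} {s : AlgState n ι}
    (h : StateInv γ q m a b s) : IsUnnormalizedGaussian γ s.σ := by
  obtain ⟨U, c, M, -, -, h3, -, h5, -, -, h8, -⟩ := h
  -- The dimension in λ compensates for the division by tr(I) in the definition.
  refine ⟨c * Fintype.card ι, M, by positivity, h5, ?_⟩
  have h0 : (Fintype.card ι : ℂ) ≠ 0 := by exact_mod_cast Fintype.card_ne_zero
  rw [h8, trace_one, Complex.ofReal_mul, Complex.ofReal_natCast, mul_div_cancel_right₀ _ h0]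
  exact (Complex.coe_smul c _).symm

theorem structuralAlgorithm_spec [Nonempty ι] (hγ : IsMajorana γ) (hβ : 0 ≤ β) (hN : 24 ≤ N)
    (hβN : β * d * (N * R) ≤ 1 / 2) :
    (∀ σ ∈ (structuralAlgorithm H γ β N).support, IsUnnormalizedGaussian γ σ) ∧
      HasSum (fun σ => (structuralAlgorithm H γ β N σ).toReal • σ) (H.boltzmann γ β) := by
  obtain ⟨h1, h2⟩ := algRun_spec (H := H) hγ hβ hN hβN (2 * n) le_rfl
  have hσ : ∀ s ∈ (algRun H γ β N (2 * n)).support, stateValue H γ β s = s.σ := by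
    intro s hs
    obtain ⟨hS, hΓ⟩ := (h1 s hs).Γ_eq_zero
    simp [stateValue, hS, hΓ, H.halfBoltzmann_empty]
  constructor
  · intro σ hσ'
    obtain ⟨s, hs, rfl⟩ := (PMF.mem_support_map_iff _ _ _).1 hσ'
    exact (h1 s hs).2.1.isUnnormalizedGaussian
  · obtain ⟨C, hC⟩ := exists_norm_stateValue_le hγ H β (2 * n)
    refine HasMean.map (f := fun σ => σ) (C := C) (fun s hs => ?_) (h2.congr hσ)
    rw [← hσ s hs]
    exact hC s (h1 s hs)

/-! ### The Gibbs state -/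

/-- Only the identity survives the trace: γ k anticommutes with its partner γ l and commutes with
the remaining pairs, so by cyclicity the trace of the other part equals its own negative. -/
theorem IsPartialMatching.trace_matchingProd (hγ : IsMajorana γ)
    {M : List (Fin (2 * n) × Fin (2 * n) × ℤˣ)} (hM : IsPartialMatching M) :
    (matchingProd γ M).trace = trace (1 : Matrix ι ι ℂ) := by
  induction M with
  | nil => simp [matchingProd]
  | cons p M ih =>
    obtain ⟨k, l, e⟩ := p
    unfold IsPartialMatching at hM ih
    rw [List.flatMap_cons] at hM
    simp only [List.cons_append, List.nil_append, List.nodup_cons, List.mem_cons, not_or] at hM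
    obtain ⟨⟨hkl, hk⟩, hl, hM⟩ := hM
    set X := matchingProd γ M with hX
    have hcomm : ∀ p ∈ M, ((p.1 ≠ k ∧ p.2.1 ≠ k)) := by
      intro p hp
      refine ⟨fun h => hk (List.mem_flatMap.2 ⟨p, hp, by simp [h]⟩),
        fun h => hk (List.mem_flatMap.2 ⟨p, hp, by simp [h]⟩)⟩
    have hkX : Commute (γ k) X := by
      refine Commute.list_prod_right _ _ fun m hm => ?_
      obtain ⟨p, hp, rfl⟩ := List.mem_map.1 hm
      refine (Commute.one_right _).add_right (Commute.smul_right ?_ _)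
      rw [commute_iff_eq, ← mul_assoc, hγ.anticomm k p.1 (hcomm p hp).1.symm, neg_mul, mul_assoc,
        hγ.anticomm k p.2.1 (hcomm p hp).2.symm, mul_neg, neg_neg, mul_assoc]
    have h0 : (γ k * γ l * X).trace = 0 := by
      have h1 : (γ k * γ l * X).trace = -(γ k * γ l * X).trace := by
        conv_lhs => rw [hγ.anticomm k l hkl, neg_mul, trace_neg, mul_assoc, hkX.eq, ← mul_assoc,
          trace_mul_comm, ← mul_assoc]
      exact self_eq_neg.1 h1
    have hcons : matchingProd γ ((k, l, e) :: M) =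
        X + (((e : ℤ) : ℂ) * Complex.I) • (γ k * γ l * X) := by
      rw [matchingProd, List.map_cons, List.prod_cons, add_mul, one_mul, smul_mul_assoc]
      rfl
    rw [hcons, trace_add, trace_smul, h0, smul_zero, add_zero]
    exact ih hM

theorem IsGaussianState.trace_eq_one [Nonempty ι] (hγ : IsMajorana γ) {ρ : Matrix ι ι ℂ}
    (h : IsGaussianState γ ρ) : ρ.trace = 1 := by
  obtain ⟨M, hM, rfl⟩ := h
  rw [trace_smul, hM.trace_matchingProd hγ, smul_eq_mul, inv_mul_cancel₀ trace_one_ne_zero]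

theorem finite_isGaussianState (γ : Fin (2 * n) → Matrix ι ι ℂ) :
    {ρ | IsGaussianState γ ρ}.Finite := by
  have hfin : {M : List (Fin (2 * n) × Fin (2 * n) × ℤˣ) | M.length ≤ 2 * n}.Finite :=
    List.finite_length_le _ _
  refine (hfin.image fun M => (trace (1 : Matrix ι ι ℂ))⁻¹ • matchingProd γ M).subset ?_
  rintro ρ ⟨M, hM, rfl⟩
  refine ⟨M, ?_, rfl⟩
  -- The flattened matching has no repeated index, so its length 2|M| is at most 2n; only finitely
  -- many lists remain.
  have h1 : (M.flatMap fun p => [p.1, p.2.1]).length ≤ Fintype.card (Fin (2 * n)) :=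
    List.Nodup.length_le_card hM
  rw [Fintype.card_fin, List.length_flatMap] at h1
  simp at h1
  simp only [Set.mem_ofPred_eq]
  omega

/-- A nonzero operator that is an unconditionally convergent sum of nonnegative multiples of
elements of a finite set of trace-one operators is, up to normalization, a convex combination of
elements of that set. -/
theorem mem_convexHull_of_hasSum {α κ : Type*} [Fintype κ] {s : Set (Matrix κ κ ℂ)} (hs : s.Finite)
    (htr : ∀ ρ ∈ s, ρ.trace = 1) {w : α → ℝ} {ρ : α → Matrix κ κ ℂ} (hw : ∀ a, 0 ≤ w a)
    (hρ : ∀ a, w a ≠ 0 → ρ a ∈ s) {B : Matrix κ κ ℂ} (hB : B ≠ 0)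
    (h : HasSum (fun a => w a • ρ a) B) : B.trace⁻¹ • B ∈ convexHull ℝ s := by
  classical
  have htrw : ∀ a, (w a • ρ a).trace = (w a : ℂ) := by
    intro a
    by_cases ha : w a = 0
    · simp [ha]
    · rw [trace_smul, htr _ (hρ a ha)]; simp
  have hsumC : HasSum (fun a => (w a : ℂ)) B.trace := by
    have := h.map (traceAddMonoidHom κ ℂ) (continuous_id.matrix_trace)
    refine Eq.subst (motive := fun f => HasSum f B.trace) (funext fun a => ?_) this
    exact htrw a
  have hsum : Summable w := Complex.summable_ofReal.1 hsumC.summable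
  -- The weights are grouped by the value of ρ, which turns the infinite combination into a finite
  -- one over s. No closure of the hull is needed.
  set u : Matrix κ κ ℂ → α → ℝ := fun τ a => if ρ a = τ then w a else 0 with hu
  have hu0 : ∀ τ a, 0 ≤ u τ a := fun τ a => by simp only [hu]; split_ifs <;> simp [hw]
  have hule : ∀ τ a, u τ a ≤ w a := fun τ a => by simp only [hu]; split_ifs <;> simp [hw]
  have hus : ∀ τ, Summable (u τ) := fun τ => Summable.of_nonneg_of_le (hu0 τ) (hule τ) hsum
  have hdec : HasSum (fun a => ∑ τ ∈ hs.toFinset, u τ a • τ)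
      (∑ τ ∈ hs.toFinset, (∑' a, u τ a) • τ) :=
    hasSum_sum fun τ _ => (hus τ).hasSum.smul_const τ
  have hpt : ∀ a, ∑ τ ∈ hs.toFinset, u τ a • τ = w a • ρ a := by
    intro a
    by_cases ha : w a = 0
    · simp [hu, ha]
    · rw [Finset.sum_eq_single (ρ a)]
      · simp [hu]
      · intro τ _ hτ
        simp [hu, Ne.symm hτ]
      · intro hn
        exact absurd (hs.mem_toFinset.2 (hρ a ha)) hn
  simp only [hpt] at hdec
  have hBeq := h.unique hdec
  have htrB : B.trace = ((∑ τ ∈ hs.toFinset, ∑' a, u τ a : ℝ) : ℂ) := by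
    rw [hBeq, trace_sum, Complex.ofReal_sum]
    refine Finset.sum_congr rfl fun τ hτ => ?_
    rw [trace_smul, htr τ (hs.mem_toFinset.1 hτ)]
    simp
  have hnn : ∀ τ ∈ hs.toFinset, 0 ≤ ∑' a, u τ a := fun τ _ => tsum_nonneg (hu0 τ)
  have hpos : 0 < ∑ τ ∈ hs.toFinset, ∑' a, u τ a := by
    refine lt_of_le_of_ne (Finset.sum_nonneg hnn) fun h0 => hB ?_
    rw [hBeq]
    refine Finset.sum_eq_zero fun τ hτ => ?_
    rw [(Finset.sum_eq_zero_iff_of_nonneg hnn).1 h0.symm τ hτ, zero_smul]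
  have hmem := Finset.centerMass_mem_convexHull (R := ℝ) (s := s) hs.toFinset hnn hpos
    (z := id) fun τ hτ => hs.mem_toFinset.1 hτ
  rw [Finset.centerMass] at hmem
  convert hmem using 1
  rw [htrB, ← Complex.ofReal_inv]
  simp only [id]
  rw [← hBeq]
  exact Complex.coe_smul _ _

theorem gibbs_mem_convexHull [Nonempty ι] (hγ : IsMajorana γ) (hβ : 0 ≤ β)
    (hβN : β * d * (24 * R) ≤ 1 / 2) :
    H.gibbs γ β ∈ convexHull ℝ {ρ | IsGaussianState γ ρ} := by
  -- The smallest admissible N = 24 gives the widest range of β, and 2N = 48.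
  obtain ⟨h1, h2⟩ := structuralAlgorithm_spec (H := H) hγ hβ le_rfl hβN
  have hex : ∀ σ : Matrix ι ι ℂ, ∃ (lam : ℝ) (ρ : Matrix ι ι ℂ), 0 ≤ lam ∧
      (σ ∈ (structuralAlgorithm H γ β 24).support → IsGaussianState γ ρ ∧ σ = lam • ρ) := by
    intro σ
    by_cases hσ : σ ∈ (structuralAlgorithm H γ β 24).support
    · obtain ⟨lam, M, h0, hM, h⟩ := h1 σ hσ
      refine ⟨lam, _, h0, fun _ => ⟨⟨M, hM, rfl⟩, ?_⟩⟩
      rw [h, div_eq_mul_inv, mul_smul]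
      exact Complex.coe_smul _ _
    · exact ⟨0, 0, le_rfl, fun h => absurd h hσ⟩
  choose lam ρ hlam hρ using hex
  have hne : H.boltzmann γ β ≠ 0 := (Matrix.isUnit_exp _).ne_zero
  refine mem_convexHull_of_hasSum (finite_isGaussianState γ) (fun τ hτ => hτ.trace_eq_one hγ)
    (w := fun σ => (structuralAlgorithm H γ β 24 σ).toReal * lam σ) (ρ := ρ)
    (fun σ => mul_nonneg ENNReal.toReal_nonneg (hlam σ)) (fun σ hσ => ?_) hne ?_
  · refine (hρ σ ((PMF.mem_support_iff _ _).2 fun h => hσ ?_)).1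
    simp [h]
  · refine Eq.subst (motive := fun f => HasSum f (H.boltzmann γ β)) (funext fun σ => ?_) h2
    by_cases hσ : structuralAlgorithm H γ β 24 σ = 0
    · simp [hσ]
    · rw [mul_smul, ← (hρ σ ((PMF.mem_support_iff _ _).2 hσ)).2]

theorem mul_degree_mul_le (H : FermionicHamiltonian n R d) (hN : 24 ≤ N)
    (h : β ≤ 1 / (2 * N * R * d)) : β * d * (N * R) ≤ 1 / 2 := by
  have hR : (2 : ℝ) ≤ R := by exact_mod_cast H.two_le_locality
  have hd : (1 : ℝ) ≤ d := by exact_mod_cast H.one_le_degree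
  rw [le_div_iff₀ (by positivity)] at h
  linarith

end Output

end HighTempFermion

open HighTempFermion in
theorem theorem4p1 {n R d : ℕ} {ι : Type*} [Fintype ι] [DecidableEq ι] [Nonempty ι]
    (γ : Fin (2 * n) → Matrix ι ι ℂ) (hγ : IsMajorana γ) (H : FermionicHamiltonian n R d)
    (β : ℝ) (hβ : 0 ≤ β) :
    (∀ N : ℝ, 24 ≤ N → β ≤ 1 / (2 * N * R * d) →
      (∀ (S : Finset (Fin (2 * n))), ∀ i ∈ S,
        ∑' w, wordProb H γ β N S i w = 1 ∧
        HasSum (fun w => (wordPMF H γ β N S i w).toReal •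
          (1 + sampledScale H N w • sampledString H γ w)) (H.factor γ β S i)) ∧
      (∀ σ ∈ (structuralAlgorithm H γ β N).support, IsUnnormalizedGaussian γ σ) ∧
      HasSum (fun σ => (structuralAlgorithm H γ β N σ).toReal • σ) (H.boltzmann γ β)) ∧
    (β ≤ 1 / (48 * R * d) →
      H.gibbs γ β ∈ convexHull ℝ {ρ | IsGaussianState γ ρ}) := by
  have hR : (2 : ℝ) ≤ R := by exact_mod_cast H.two_le_locality
  refine ⟨fun N hN h => ?_, fun h => ?_⟩
  · have hβN := mul_degree_mul_le H hN h
    exact ⟨fun S i _ => ⟨tsum_wordProb hγ hβ (by linarith) hβN,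
      hasSum_wordPMF hγ hβ (by nlinarith) (by linarith) hβN⟩,
      structuralAlgorithm_spec hγ hβ hN hβN⟩
  · exact gibbs_mem_convexHull hγ hβ (mul_degree_mul_le H le_rfl (by norm_num at h ⊢; exact h))
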